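/- Let $(s,c)$ be the holomorphic solution pair, in the disc $B_r(0)$ of radius $r=4^4/5^5$, of the initial value problem $$s'=c^5,\quad c'=-s^5;\qquad s(0)=0,\ c(0)=1 .$$ Put $K=\int_0^1 (1+\xi^6)^{-1/3}\,d\xi$, $L=\int_0^1(1-\xi^6)^{-1/3}\,d\xi$ and $\delta=e^{i\pi/6}$. Let $\mathbb H_0$ be the open regular hexagon with centre $0$ and vertices $\delta L e^{ik\pi/3}$ ($0\le k\le 5$), let $\mathbb H_j=2jK+\mathbb H_0$ for $j\in\mathbb Z$, and let the band $\mathcal H$ be the union of all the $\mathbb H_j$ along with the open (vertical) edges that adjacent hexagons $\mathbb H_j,\mathbb H_{j+1}$ share. A period of a meromorphic function $F$ on $\mathcal H$ is a number $w$ such that $\mathcal H+w=\mathcal H$ and $F(z+w)=F(z)$ on $\mathcal H$; $F$ is simply periodic if it is not constant and its periods form an infinite cyclic group. Let $m,n$ be integers, not both $0$, such that $m+n$ is a multiple of $4$. Then $B_r(0)\subseteq\mathcal H$ and $s^mc^n$ extends from $B_r(0)$ to a function that is meromorphic and simply periodic in $\mathcal H$. The group of periods of this extension is $2K\mathbb Z$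 if $m=n$, and $4K\mathbb Z$ if $m\neq n$ (in particular, it is $4K\mathbb Z$ when $m$ and $n$ are both odd). -/

import Mathlib

namespace SexticSystem

/-- The pair `(s, c)` is a holomorphic solution, on the disc of radius `4 ^ 4 / 5 ^ 5` about `0`, of
the initial value problem `s' = c ^ 5`, `c' = - s ^ 5`, `s 0 = 0`, `c 0 = 1`. -/
structure IsSolutionPair (s c : ℂ → ℂ) : Prop where
  hasDerivAt_s : ∀ z ∈ Metric.ball (0 : ℂ) (4 ^ 4 / 5 ^ 5), HasDerivAt s (c z ^ 5) z
  hasDerivAt_c : ∀ z ∈ Metric.ball (0 : ℂ) (4 ^ 4 / 5 ^ 5), HasDerivAt c (-(s z) ^ 5) z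
  s_zero : s 0 = 0
  c_zero : c 0 = 1

/-- `K = ∫₀¹ dξ / (1 + ξ ^ 6) ^ (1 / 3)`. -/
noncomputable def K : ℝ := ∫ ξ in (0 : ℝ)..1, 1 / (1 + ξ ^ 6) ^ (1 / 3 : ℝ)

/-- `L = ∫₀¹ dξ / (1 - ξ ^ 6) ^ (1 / 3)`. -/
noncomputable def L : ℝ := ∫ ξ in (0 : ℝ)..1, 1 / (1 - ξ ^ 6) ^ (1 / 3 : ℝ)

/-- The primitive sixth root of unity `γ = exp (i π / 3)`. -/
noncomputable def γ : ℂ := Complex.exp (Complex.I * Real.pi / 3)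

/-- `δ = exp (i π / 6)`. -/
noncomputable def δ : ℂ := Complex.exp (Complex.I * Real.pi / 6)

/-- The open regular hexagon with centre `0` and vertices `L γ ^ k`. -/
noncomputable def hexagon : Set ℂ :=
  interior (convexHull ℝ (Set.range fun k : Fin 6 => (L : ℂ) * γ ^ (k : ℕ)))

/-- The hexagon turned through `π / 6` (so that two of its edges are vertical) and then translated
by `2 n K`. -/
noncomputable def hexagonAt (n : ℤ) : Set ℂ :=
  (fun z : ℂ => 2 * n * K + δ * z) '' hexagon

/-- The open edge that the hexagons with indices `n` and `n + 1` share: the right-hand vertical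
edge of the former, which joins `2 n K + L δ⁻¹` to `2 n K + L δ`. -/
noncomputable def sharedEdge (n : ℤ) : Set ℂ :=
  openSegment ℝ (2 * n * K + L * δ⁻¹ : ℂ) (2 * n * K + L * δ)

/-- The band: the union of the hexagons along with the open edges that adjacent hexagons share. -/
noncomputable def band : Set ℂ :=
  (⋃ n : ℤ, hexagonAt n) ∪ ⋃ n : ℤ, sharedEdge n

/-- The group of periods of a function `F` on a set `Ω`: the numbers `w` for which translation by
`w` maps `Ω` onto itself and leaves `F` unchanged there. -/
def periods (F : ℂ → ℂ) (Ω : Set ℂ) : AddSubgroup ℂ where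
  carrier := {w | ∀ z, (z + w ∈ Ω ↔ z ∈ Ω) ∧ (z ∈ Ω → F (z + w) = F z)}
  zero_mem' := by
    intro z
    simp
  add_mem' := by
    intro a b ha hb z
    rw [← add_assoc]
    refine ⟨(hb (z + a)).1.trans (ha z).1, fun hz => ?_⟩
    rw [(hb (z + a)).2 ((ha z).1.2 hz), (ha z).2 hz]
  neg_mem' := by
    intro a ha z
    have h := ha (z + -a)
    rw [neg_add_cancel_right] at h
    exact ⟨h.1.symm, fun hz => (h.2 (h.1.1 hz)).symm⟩

/-- `F` is simply periodic on `Ω`: it is not constant there, and its periods are the integer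
multiples of a single nonzero number. -/
def IsSimplyPeriodicOn (F : ℂ → ℂ) (Ω : Set ℂ) : Prop :=
  (¬ ∃ a : ℂ, ∀ z ∈ Ω, F z = a) ∧ ∃ p : ℂ, p ≠ 0 ∧ periods F Ω = AddSubgroup.zmultiples p

end SexticSystem

namespace SexticSystem

open Complex Set Filter Topology

/-! Since `s ^ 6 + c ^ 6 = 1`, the quotient `t = s / c` satisfies `t' = c⁻² = (1 + t ^ 6) ^ (1 / 3)`
near `0`. So `t` inverts the Schwarz–Christoffel map `S = schwarzMap`, and `s ^ m c ^ n = t ^ m g ^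
((m + n) / 2)` with `g = integrand t = c ^ 2`; only `m + n` even is needed for this to be
single-valued.

`S` maps the unit disc bijectively onto the open hexagon. The arc `|arg t| ≤ π / 6` goes to the edge
on `re z = K` (`re_schwarzMap_arc`). The maximum principle keeps the image inside
(`schwarzMap_mem_closedHexagon`), connectedness makes it everything (`subset_image_schwarzMap`), and
`re S' > 0` gives injectivity (`injOn_schwarzMap`).

Crossing the right-hand edge is governed by `t ↦ -1 / t`: by `integrand_inv` and `schwarzMap_inv`,
`S t = S (-1 / t) + 2 K` on the sector. Hence translation by `2 K` turns the extension for `(m, n)`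
into `(-1) ^ m` times that for `(n, m)` (`bandFunction_add`). Taken as a definition on successive
strips, this rule is consistent across the edges by `bandFunction_schwarzMap`.

Two steps give the period `4 K`, as `(-1) ^ (m + n) = 1`. One step is a period exactly when `m = n`,
where `4 ∣ 2 m` makes the sign `1`. The shape of the band allows no translations except by multiples
of `2 K` (`exists_int_of_band_translation`). -/

/-- A holomorphic function on a domain that is star-shaped about `0` has the radial primitive. -/
theorem hasDerivAt_radialPrimitive {f : ℂ → ℂ} {U : Set ℂ} (hU : IsOpen U)
    (hstar : ∀ z ∈ U, ∀ x ∈ Icc (0 : ℝ) 1, (x : ℂ) * z ∈ U) (hf : DifferentiableOn ℂ f U)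
    {z : ℂ} (hz : z ∈ U) :
    HasDerivAt (fun w => ∫ x in (0 : ℝ)..1, w * f (x * w)) (f z) z := by
  obtain ⟨ε, hε, hball⟩ := Metric.nhds_basis_closedBall.mem_iff.1 (hU.mem_nhds hz)
  have hfa : ∀ w ∈ U, DifferentiableAt ℂ f w := fun w hw => hf.differentiableAt (hU.mem_nhds hw)
  have hdf : ContinuousOn (deriv f) U := (hf.deriv hU).continuousOn
  have hmul : ContinuousOn (fun p : ℝ × ℂ => (p.1 : ℂ) * p.2)
      (Icc (0 : ℝ) 1 ×ˢ Metric.closedBall z ε) := by fun_prop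
  have hmaps : MapsTo (fun p : ℝ × ℂ => (p.1 : ℂ) * p.2)
      (Icc (0 : ℝ) 1 ×ˢ Metric.closedBall z ε) U := fun p hp =>
    hstar _ (hball hp.2) _ hp.1
  have hG : ContinuousOn (fun p : ℝ × ℂ => f (p.1 * p.2) + p.2 * (deriv f (p.1 * p.2) * p.1))
      (Icc (0 : ℝ) 1 ×ˢ Metric.closedBall z ε) := by
    refine (hf.continuousOn.comp hmul hmaps).add (continuousOn_snd.mul
      ((hdf.comp hmul hmaps).mul ?_))
    fun_prop
  obtain ⟨C, hC⟩ := (isCompact_Icc.prod (isCompact_closedBall z ε)).exists_bound_of_continuousOn hG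
  have hslice : ∀ w ∈ Metric.closedBall z ε, MapsTo (fun x : ℝ => (x, w)) (Icc (0 : ℝ) 1)
      (Icc (0 : ℝ) 1 ×ˢ Metric.closedBall z ε) := fun w hw x hx => ⟨hx, hw⟩
  have hcont : ∀ w ∈ Metric.closedBall z ε,
      ContinuousOn (fun x : ℝ => w * f (x * w)) (Icc (0 : ℝ) 1) := fun w hw =>
    continuousOn_const.mul ((hf.continuousOn.comp hmul hmaps).comp
      (by fun_prop) (hslice w hw))
  have hcont' : ContinuousOn (fun x : ℝ => f (x * z) + z * (deriv f (x * z) * x))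
      (Icc (0 : ℝ) 1) :=
    hG.comp (f := fun x : ℝ => (x, z)) (by fun_prop) (hslice z (Metric.mem_closedBall_self hε.le))
  have key := intervalIntegral.hasDerivAt_integral_of_dominated_loc_of_deriv_le
    (μ := MeasureTheory.volume) (a := (0 : ℝ)) (b := 1)
    (F := fun w (x : ℝ) => w * f (x * w))
    (F' := fun w (x : ℝ) => f (x * w) + w * (deriv f (x * w) * x))
    (x₀ := z) (s := Metric.ball z ε) (bound := fun _ => C) (Metric.ball_mem_nhds z hε)
    (by
      filter_upwards [Metric.ball_mem_nhds z hε] with w hw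
      have := (hcont w (Metric.ball_subset_closedBall hw)).mono
        (uIoc_subset_uIcc.trans (uIcc_of_le zero_le_one).subset)
      exact this.aestronglyMeasurable measurableSet_uIoc)
    (by
      refine ContinuousOn.intervalIntegrable ?_
      rw [uIcc_of_le zero_le_one]
      exact hcont z (Metric.mem_closedBall_self hε.le))
    (by
      have := hcont'.mono (uIoc_subset_uIcc.trans (uIcc_of_le zero_le_one).subset)
      exact this.aestronglyMeasurable measurableSet_uIoc)
    (by
      refine Eventually.of_forall fun x hx w hw => ?_
      rw [uIoc_of_le zero_le_one] at hx
      exact hC (x, w) ⟨Ioc_subset_Icc_self hx, Metric.ball_subset_closedBall hw⟩)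
    (by simp)
    (by
      refine Eventually.of_forall fun x hx w hw => ?_
      rw [uIoc_of_le zero_le_one] at hx
      have h1 : DifferentiableAt ℂ f (x * w) :=
        hfa _ (hstar _ (hball (Metric.ball_subset_closedBall hw)) _ (Ioc_subset_Icc_self hx))
      have h2 : HasDerivAt (fun w : ℂ => (x : ℂ) * w) x w := by
        simpa using (hasDerivAt_id w).const_mul (x : ℂ)
      refine ((hasDerivAt_id w).mul (h1.hasDerivAt.comp w h2)).congr_deriv ?_
      simp)
  -- The integrand obtained by differentiating under the integral sign is the `x`-derivative of `x
  -- f(xz)`.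
  have hint : ∫ x in (0 : ℝ)..1, (f (x * z) + z * (deriv f (x * z) * x)) = f z := by
    have := intervalIntegral.integral_eq_sub_of_hasDerivAt
      (f := fun x : ℝ => (x : ℂ) * f (x * z))
      (f' := fun x : ℝ => f (x * z) + z * (deriv f (x * z) * x)) (a := 0) (b := 1)
      (by
        intro x hx
        rw [uIcc_of_le zero_le_one] at hx
        have h1 : DifferentiableAt ℂ f (x * z) := hfa _ (hstar _ hz _ hx)
        have h3 : HasDerivAt (fun x : ℝ => (x : ℂ)) 1 x := ofRealCLM.hasDerivAt
        have h2 : HasDerivAt (fun x : ℝ => (x : ℂ) * z) z x := by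
          simpa using h3.mul_const z
        have h4 := h3.mul (HasDerivAt.comp_of_eq x h1.hasDerivAt h2 rfl)
        refine h4.congr_deriv ?_
        simp only [one_mul, Function.comp]
        ring)
      (by
        refine ContinuousOn.intervalIntegrable ?_
        rwa [uIcc_of_le zero_le_one])
    simpa using this
  rw [← hint]
  exact key.2

/-- Noshiro–Warschawski: a function whose derivative has positive real part on a convex set is
injective there. -/
theorem injOn_of_re_deriv_pos {f f' : ℂ → ℂ} {A : Set ℂ} (hA : Convex ℝ A)
    (hf : ∀ z ∈ A, HasDerivAt f (f' z) z) (hpos : ∀ z ∈ A, 0 < (f' z).re) : InjOn f A := by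
  intro a ha b hb hab
  by_contra hne
  have hba : b - a ≠ 0 := sub_ne_zero.2 (Ne.symm hne)
  have hseg : ∀ x ∈ Icc (0 : ℝ) 1, a + x * (b - a) ∈ A := fun x hx => by
    have := hA.add_smul_sub_mem ha hb hx
    simpa using this
  -- Projecting `f` onto the direction `b - a` gives a strictly increasing real function along the
  -- segment.
  have hder : ∀ x ∈ Icc (0 : ℝ) 1, HasDerivAt
      (fun x : ℝ => ((starRingEnd ℂ) (b - a) * f (a + x * (b - a))).re)
      (normSq (b - a) * (f' (a + x * (b - a))).re) x := by
    intro x hx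
    have h3 : HasDerivAt (fun x : ℝ => (x : ℂ)) 1 x := ofRealCLM.hasDerivAt
    have h2 : HasDerivAt (fun x : ℝ => a + (x : ℂ) * (b - a)) (b - a) x := by
      simpa using (h3.mul_const (b - a)).const_add a
    have h4 := (HasDerivAt.comp_of_eq x (hf _ (hseg x hx)) h2 rfl).const_mul
      ((starRingEnd ℂ) (b - a))
    have h5 := reCLM.hasFDerivAt.comp_hasDerivAt x h4
    refine h5.congr_deriv ?_
    rw [reCLM_apply, mul_comm (f' _), ← mul_assoc, ← normSq_eq_conj_mul_self, re_ofReal_mul]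
  have hmono := strictMonoOn_of_deriv_pos (convex_Icc (0 : ℝ) 1)
    (fun x hx => (hder x hx).continuousAt.continuousWithinAt)
    (fun x hx => by
      rw [(hder x (interior_subset hx)).deriv]
      exact mul_pos (normSq_pos.2 hba) (hpos _ (hseg x (interior_subset hx))))
  have := hmono (left_mem_Icc.2 zero_le_one) (right_mem_Icc.2 zero_le_one) zero_lt_one
  simp [hab] at this

/-! ### The Schwarz–Christoffel integrand and its primitive -/

/-- The principal branch of `(1 + t ^ 6) ^ (-1 / 3)`. -/
noncomputable def integrand (t : ℂ) : ℂ := (1 + t ^ 6) ^ (-(1 / 3) : ℂ)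

/-- The Schwarz–Christoffel map `t ↦ ∫₀ᵗ (1 + τ ^ 6) ^ (-1 / 3) dτ` along radii. -/
noncomputable def schwarzMap (t : ℂ) : ℂ := ∫ x in (0 : ℝ)..1, t * integrand (x * t)

/-- The plane slit along the six rays that lead from the sixth roots of `-1` to infinity. -/
def slitDomain : Set ℂ := {t | 1 + t ^ 6 ∈ slitPlane}

/-- The open sector `|arg t| < π / 6`. -/
def sector : Set ℂ := {t | √3 * |t.im| < t.re}

theorem integrand_pow_three (t : ℂ) : integrand t ^ 3 = (1 + t ^ 6)⁻¹ := by
  rw [integrand, ← cpow_nat_mul, ← cpow_neg_one]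
  norm_num

theorem integrand_ne_zero {t : ℂ} (ht : 1 + t ^ 6 ≠ 0) : integrand t ≠ 0 := by
  intro h
  have := integrand_pow_three t
  rw [h, zero_pow three_ne_zero, eq_comm, inv_eq_zero] at this
  exact ht this

theorem integrand_zero : integrand 0 = 1 := by simp [integrand]

/-- The argument of the principal power is `-arg w / 3`, at most `π / 3` in size. This is what makes
the map univalent on convex sets. -/
theorem re_cpow_neg_third_pos {w : ℂ} (hw : w ≠ 0) : 0 < (w ^ (-(1 / 3) : ℂ)).re := by
  rw [cpow_def_of_ne_zero hw, exp_re]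
  refine mul_pos (Real.exp_pos _) (Real.cos_pos_of_mem_Ioo ?_)
  have h : (log w * (-(1 / 3) : ℂ)).im = -(w.arg / 3) := by
    rw [show (-(1 / 3) : ℂ) = ((-(1 / 3) : ℝ) : ℂ) by push_cast; ring, im_mul_ofReal, log_im]
    ring
  rw [h]
  constructor <;> linarith [neg_pi_lt_arg w, arg_le_pi w, Real.pi_pos]

theorem re_integrand_pos {t : ℂ} (ht : 1 + t ^ 6 ≠ 0) : 0 < (integrand t).re :=
  re_cpow_neg_third_pos ht

theorem isOpen_slitDomain : IsOpen slitDomain :=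
  isOpen_slitPlane.preimage (by fun_prop)

theorem one_add_ne_zero_of_mem_slitDomain {t : ℂ} (ht : t ∈ slitDomain) : 1 + t ^ 6 ≠ 0 :=
  slitPlane_ne_zero ht

theorem smul_mem_slitDomain {t : ℂ} (ht : t ∈ slitDomain) {x : ℝ} (hx : x ∈ Icc (0 : ℝ) 1) :
    (x : ℂ) * t ∈ slitDomain := by
  have h6 : ((x : ℂ) * t) ^ 6 = ((x ^ 6 : ℝ) : ℂ) * t ^ 6 := by push_cast; ring
  have hx6 : x ^ 6 ≤ 1 := pow_le_one₀ hx.1 hx.2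
  have hx0 : 0 ≤ x ^ 6 := pow_nonneg hx.1 6
  simp only [slitDomain, mem_ofPred_eq, mem_slitPlane_iff, h6, add_re, one_re, add_im, one_im,
    re_ofReal_mul, im_ofReal_mul, zero_add] at ht ⊢
  rcases hx0.eq_or_lt with h0 | h0
  · simp [← h0]
  rcases ht with ht | ht
  · left
    nlinarith
  · right
    exact mul_ne_zero h0.ne' ht

theorem mem_slitDomain_of_norm_lt_one {t : ℂ} (ht : ‖t‖ < 1) : t ∈ slitDomain := by
  left
  have h1 : ‖t ^ 6‖ < 1 := by
    rw [norm_pow]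
    exact pow_lt_one₀ (norm_nonneg _) ht (by norm_num)
  have h2 := (abs_le.1 ((abs_re_le_norm (t ^ 6)).trans h1.le)).1
  have h3 := (abs_lt.1 ((abs_re_le_norm (t ^ 6)).trans_lt h1)).1
  simp only [add_re, one_re]
  linarith

theorem differentiableOn_integrand : DifferentiableOn ℂ integrand slitDomain := by
  intro t ht
  exact (DifferentiableAt.cpow_const (f := fun t : ℂ => 1 + t ^ 6) (by fun_prop)
    ht).differentiableWithinAt

theorem hasDerivAt_schwarzMap {t : ℂ} (ht : t ∈ slitDomain) :
    HasDerivAt schwarzMap (integrand t) t :=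
  hasDerivAt_radialPrimitive isOpen_slitDomain (fun _ hz _ hx => smul_mem_slitDomain hz hx)
    differentiableOn_integrand ht

theorem schwarzMap_zero : schwarzMap 0 = 0 := by simp [schwarzMap]

theorem schwarzMap_mul {ω : ℂ} (hω : ω ^ 6 = 1) (t : ℂ) :
    schwarzMap (ω * t) = ω * schwarzMap t := by
  rw [schwarzMap, schwarzMap, ← intervalIntegral.integral_const_mul]
  congr 1
  ext x
  rw [integrand, integrand, show ((x : ℂ) * (ω * t)) ^ 6 = ω ^ 6 * (x * t) ^ 6 by ring, hω, one_mul,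
    mul_assoc]

theorem schwarzMap_neg (t : ℂ) : schwarzMap (-t) = -schwarzMap t := by
  simpa using schwarzMap_mul (ω := -1) (by norm_num) t

/-! ### The sector -/

/-- Follows from `re (t ^ 3) = re t * ((re t) ^ 2 - 3 (im t) ^ 2)`. In this form invariance under
inversion is plain, and `t ^ 3` lies where the principal logarithm is additive. -/
theorem mem_sector_iff {t : ℂ} : t ∈ sector ↔ 0 < t.re ∧ 0 < (t ^ 3).re := by
  have h3 : (t ^ 3).re = t.re * (t.re ^ 2 - 3 * t.im ^ 2) := by
    simp only [pow_succ, pow_zero, one_mul, mul_re, mul_im]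
    ring
  have hs : (√3 * |t.im|) ^ 2 = 3 * t.im ^ 2 := by
    rw [mul_pow, sq_abs, Real.sq_sqrt (by norm_num)]
  have hn : 0 ≤ √3 * |t.im| := by positivity
  rw [h3, ← hs]
  constructor
  · intro h
    have h : √3 * |t.im| < t.re := h
    have h0 := hn.trans_lt h
    exact ⟨h0, mul_pos h0 (by nlinarith)⟩
  · rintro ⟨h0, h⟩
    exact lt_of_pow_lt_pow_left₀ 2 h0.le (by linarith [(mul_pos_iff_of_pos_left h0).1 h])

theorem isOpen_sector : IsOpen sector :=
  isOpen_lt (by fun_prop) continuous_re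

theorem convex_sector : Convex ℝ sector := by
  intro a ha b hb x y hx hy hxy
  have ha : √3 * |a.im| < a.re := ha
  have hb : √3 * |b.im| < b.re := hb
  show √3 * |(x • a + y • b).im| < (x • a + y • b).re
  simp only [add_im, add_re, smul_im, smul_re, smul_eq_mul]
  have h1 : |x * a.im + y * b.im| ≤ x * |a.im| + y * |b.im| := by
    refine (abs_add_le _ _).trans ?_
    rw [abs_mul, abs_mul, abs_of_nonneg hx, abs_of_nonneg hy]
  have h2 := mul_le_mul_of_nonneg_left h1 (Real.sqrt_nonneg 3)
  rcases hx.eq_or_lt with rfl | hx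
  · have : y = 1 := by linarith
    subst this
    linarith
  · nlinarith [mul_lt_mul_of_pos_left ha hx, mul_le_mul_of_nonneg_left hb.le hy]

theorem sector_ne_zero {t : ℂ} (ht : t ∈ sector) : t ≠ 0 := by
  rintro rfl
  simpa using (mem_sector_iff.1 ht).1

theorem inv_re_pos {t : ℂ} (ht : 0 < t.re) : 0 < (t⁻¹).re := by
  rw [inv_re]
  refine div_pos ht (normSq_pos.2 ?_)
  rintro rfl
  simp at ht

theorem inv_mem_sector {t : ℂ} (ht : t ∈ sector) : t⁻¹ ∈ sector := by
  rw [mem_sector_iff] at ht ⊢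
  rw [inv_pow]
  exact ⟨inv_re_pos ht.1, inv_re_pos ht.2⟩

theorem sector_subset_slitDomain : sector ⊆ slitDomain := by
  intro t ht
  have h3 := (mem_sector_iff.1 ht).2
  have h6 : t ^ 6 = t ^ 3 * t ^ 3 := by ring
  simp only [slitDomain, mem_ofPred_eq, mem_slitPlane_iff, h6, add_re, one_re, add_im, one_im,
    mul_re, mul_im, zero_add]
  by_cases him : (t ^ 3).im = 0
  · left
    rw [him]
    nlinarith
  · right
    intro h
    have : (t ^ 3).re * (t ^ 3).im = 0 := by linarith
    exact (mul_ne_zero h3.ne' him) this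

/-- Products of two points of the sector have positive real part, so the factor `a² + ab + b²` of
`a³ - b³` cannot vanish. -/
theorem eq_of_pow_three_eq_of_mem_sector {a b : ℂ} (ha : a ∈ sector) (hb : b ∈ sector)
    (h : a ^ 3 = b ^ 3) : a = b := by
  have key : ∀ {u v : ℂ}, u ∈ sector → v ∈ sector → 0 < (u * v).re := by
    intro u v hu hv
    have h3 : (1 : ℝ) ≤ √3 := Real.one_le_sqrt.2 (by norm_num)
    have hu : |u.im| < u.re :=
      (le_mul_of_one_le_left (abs_nonneg _) h3).trans_lt (show √3 * |u.im| < u.re from hu)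
    have hv : |v.im| < v.re :=
      (le_mul_of_one_le_left (abs_nonneg _) h3).trans_lt (show √3 * |v.im| < v.re from hv)
    have h1 : u.im * v.im ≤ |u.im| * |v.im| := by
      rw [← abs_mul]
      exact le_abs_self _
    have h2 : |u.im| * |v.im| < u.re * v.re :=
      mul_lt_mul'' hu hv (abs_nonneg _) (abs_nonneg _)
    rw [mul_re]
    linarith
  have hne : a * a + a * b + b * b ≠ 0 := by
    intro h0
    have := congrArg re h0
    rw [add_re, add_re, zero_re] at this
    linarith [key ha ha, key ha hb, key hb hb]
  have : (a - b) * (a * a + a * b + b * b) = 0 := by linear_combination h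
  exact sub_eq_zero.1 ((mul_eq_zero.1 this).resolve_right hne)

theorem exp_third_log_pow_three {t : ℂ} (ht : t ∈ sector) : exp (log (t ^ 3) / 3) = t := by
  have h3 := (mem_sector_iff.1 ht).2
  have h0 : t ^ 3 ≠ 0 := pow_ne_zero 3 (sector_ne_zero ht)
  have hcube : exp (log (t ^ 3) / 3) ^ 3 = t ^ 3 := by
    rw [← exp_nat_mul, Nat.cast_ofNat, mul_div_cancel₀ _ (by norm_num), exp_log h0]
  refine eq_of_pow_three_eq_of_mem_sector (mem_sector_iff.2 ⟨?_, by rwa [hcube]⟩) ht hcube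
  rw [exp_re]
  refine mul_pos (Real.exp_pos _) (Real.cos_pos_of_mem_Ioo ?_)
  have h : (log (t ^ 3) / 3).im = (t ^ 3).arg / 3 := by
    rw [show (3 : ℂ) = ((3 : ℝ) : ℂ) by norm_num, div_ofReal_im, log_im]
  rw [h]
  constructor <;> linarith [neg_pi_lt_arg (t ^ 3), arg_le_pi (t ^ 3), Real.pi_pos]

/-- With `p = t ^ 3`, one has `1 + t ^ 6 = p (p + p⁻¹)` and `1 + t⁻¹ ^ 6 = p⁻¹ (p + p⁻¹)`. All
factors lie in the right half-plane, so principal logarithms add and the branches differ by `p ^ (2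
/ 3) = t ^ 2`. -/
theorem integrand_inv {t : ℂ} (ht : t ∈ sector) : integrand t⁻¹ = t ^ 2 * integrand t := by
  have hp := (mem_sector_iff.1 ht).2
  have ht0 := sector_ne_zero ht
  have hp0 : t ^ 3 ≠ 0 := pow_ne_zero 3 ht0
  set p := t ^ 3 with hpdef
  have hpi := inv_re_pos hp
  have hu : 0 < (p + p⁻¹).re := by rw [add_re]; linarith
  have hu0 : p + p⁻¹ ≠ 0 := by
    intro h
    rw [h] at hu
    simp at hu
  have hlog : ∀ {a b : ℂ}, 0 < a.re → 0 < b.re → log (a * b) = log a + log b := by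
    intro a b ha hb
    have ha' := abs_lt.1 (abs_arg_lt_pi_div_two_iff.2 (Or.inl ha))
    have hb' := abs_lt.1 (abs_arg_lt_pi_div_two_iff.2 (Or.inl hb))
    refine log_mul ?_ ?_ ⟨by linarith [ha'.1, hb'.1], by linarith [ha'.2, hb'.2]⟩
    · rintro rfl
      simp at ha
    · rintro rfl
      simp at hb
  have harg : p.arg ≠ Real.pi := by
    have := abs_lt.1 (abs_arg_lt_pi_div_two_iff.2 (Or.inl hp))
    intro h
    linarith [this.2, Real.pi_pos]
  have e1 : 1 + t ^ 6 = p * (p + p⁻¹) := by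
    rw [mul_add, mul_inv_cancel₀ hp0, hpdef]
    ring
  have e2 : 1 + t⁻¹ ^ 6 = p⁻¹ * (p + p⁻¹) := by
    rw [mul_add, inv_mul_cancel₀ hp0, hpdef, inv_pow]
    field_simp
  have e3 : t ^ 2 = exp (log p * (2 / 3)) := by
    conv_lhs => rw [← exp_third_log_pow_three ht]
    rw [← exp_nat_mul]
    congr 1
    push_cast
    ring
  rw [integrand, integrand, e1, e2, cpow_def_of_ne_zero (mul_ne_zero (inv_ne_zero hp0) hu0),
    cpow_def_of_ne_zero (mul_ne_zero hp0 hu0), hlog hpi hu, hlog hp hu, log_inv _ harg, e3,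
    ← exp_add]
  congr 1
  ring

/-! ### Continuity up to the unit circle and special values -/

theorem norm_integrand (t : ℂ) : ‖integrand t‖ = ‖1 + t ^ 6‖ ^ (-(1 / 3) : ℝ) := by
  rw [integrand, show (-(1 / 3) : ℂ) = ((-(1 / 3) : ℝ) : ℂ) by push_cast; ring,
    norm_cpow_real]

theorem norm_smul_lt_one {t : ℂ} (ht : ‖t‖ ≤ 1) {x : ℝ} (hx : x ∈ Ico (0 : ℝ) 1) :
    ‖(x : ℂ) * t‖ < 1 := by
  rw [norm_mul, norm_real, Real.norm_of_nonneg hx.1]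
  exact (mul_le_of_le_one_right hx.1 ht).trans_lt hx.2

/-- An integrable majorant independent of `t`; it gives continuity on the closed disc even at the
branch points. -/
theorem norm_integrand_le {t : ℂ} (ht : ‖t‖ ≤ 1) {x : ℝ} (hx : x ∈ Ico (0 : ℝ) 1) :
    ‖t * integrand (x * t)‖ ≤ (1 - x) ^ (-(1 / 3) : ℝ) := by
  have h6 : ‖((x : ℂ) * t) ^ 6‖ ≤ x := by
    rw [mul_pow, norm_mul, norm_pow, norm_pow, norm_real, Real.norm_of_nonneg hx.1]
    calc x ^ 6 * ‖t‖ ^ 6 ≤ x ^ 6 * 1 := by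
          gcongr
          exact pow_le_one₀ (norm_nonneg _) ht
      _ ≤ x := by
          rw [mul_one]
          exact pow_le_of_le_one hx.1 hx.2.le (by norm_num)
  have h1 : 1 - x ≤ ‖1 + ((x : ℂ) * t) ^ 6‖ := by
    have := norm_sub_le (1 + ((x : ℂ) * t) ^ 6) (((x : ℂ) * t) ^ 6)
    rw [add_sub_cancel_right, norm_one] at this
    linarith
  rw [norm_mul, norm_integrand]
  refine (mul_le_of_le_one_left (by positivity) ht).trans ?_
  exact Real.rpow_le_rpow_of_nonpos (by linarith [hx.2]) h1 (by norm_num)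

theorem ae_restrict_lt_one :
    ∀ᵐ x : ℝ ∂MeasureTheory.volume, x ∈ uIoc (0 : ℝ) 1 → x ∈ Ico (0 : ℝ) 1 := by
  have : ∀ᵐ x : ℝ ∂MeasureTheory.volume, x ≠ 1 := by simp [MeasureTheory.ae_iff]
  filter_upwards [this] with x hx hx'
  rw [uIoc_of_le zero_le_one] at hx'
  exact ⟨hx'.1.le, lt_of_le_of_ne hx'.2 hx⟩

theorem continuousOn_schwarzMap : ContinuousOn schwarzMap (Metric.closedBall 0 1) := by
  intro t ht
  refine intervalIntegral.continuousWithinAt_of_dominated_interval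
    (bound := fun x => (1 - x) ^ (-(1 / 3) : ℝ)) ?_ ?_ ?_ ?_
  · refine Eventually.of_forall fun w => Measurable.aestronglyMeasurable ?_
    unfold integrand
    fun_prop
  · filter_upwards [self_mem_nhdsWithin] with w hw
    filter_upwards [ae_restrict_lt_one] with x hx hx'
    exact norm_integrand_le (by simpa using hw) (hx hx')
  · have h := intervalIntegral.intervalIntegrable_rpow' (a := 0) (b := 1) (r := -(1 / 3))
      (by norm_num)
    simpa using (h.comp_sub_left 1).symm
  · filter_upwards [ae_restrict_lt_one] with x hx hx'
    have h1 : (x : ℂ) * t ∈ slitDomain :=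
      mem_slitDomain_of_norm_lt_one (norm_smul_lt_one (by simpa using ht) (hx hx'))
    have h2 : ContinuousAt integrand (x * t) :=
      (differentiableOn_integrand.differentiableAt (isOpen_slitDomain.mem_nhds h1)).continuousAt
    have h3 : ContinuousAt (fun t : ℂ => (x : ℂ) * t) t := by fun_prop
    exact (continuousAt_id.mul (ContinuousAt.comp (f := fun t : ℂ => (x : ℂ) * t) h2
      h3)).continuousWithinAt

theorem ofReal_cpow_neg_third {y : ℝ} (hy : 0 ≤ y) :
    (y : ℂ) ^ (-(1 / 3) : ℂ) = ((1 / y ^ (1 / 3 : ℝ) : ℝ) : ℂ) := by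
  rw [show (-(1 / 3) : ℂ) = ((-(1 / 3) : ℝ) : ℂ) by push_cast; ring, ← ofReal_cpow hy,
    Real.rpow_neg hy, one_div]
  norm_num

theorem schwarzMap_one : schwarzMap 1 = K := by
  rw [schwarzMap, K, ← intervalIntegral.integral_ofReal]
  refine intervalIntegral.integral_congr fun x hx => ?_
  rw [uIcc_of_le zero_le_one] at hx
  have h : (1 : ℂ) + ((x : ℂ) * 1) ^ 6 = ((1 + x ^ 6 : ℝ) : ℂ) := by push_cast; ring
  simp only [integrand, one_mul]
  rw [h, ofReal_cpow_neg_third (by positivity)]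

theorem δ_pow_six : δ ^ 6 = -1 := by
  rw [δ, ← exp_nat_mul, ← exp_pi_mul_I]
  congr 1
  push_cast
  ring

theorem γ_pow_six : γ ^ 6 = 1 := by
  rw [γ, ← exp_nat_mul, ← exp_two_pi_mul_I]
  congr 1
  push_cast
  ring

theorem γ_pow_three : γ ^ 3 = -1 := by
  rw [γ, ← exp_nat_mul, ← exp_pi_mul_I]
  congr 1
  push_cast
  ring

theorem schwarzMap_δ : schwarzMap δ = δ * L := by
  rw [schwarzMap, intervalIntegral.integral_const_mul, L, ← intervalIntegral.integral_ofReal]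
  congr 1
  refine intervalIntegral.integral_congr fun x hx => ?_
  rw [uIcc_of_le zero_le_one] at hx
  have h : (1 : ℂ) + ((x : ℂ) * δ) ^ 6 = ((1 - x ^ 6 : ℝ) : ℂ) := by
    rw [mul_pow, δ_pow_six]
    push_cast
    ring
  simp only [integrand]
  rw [h, ofReal_cpow_neg_third (sub_nonneg.2 (pow_le_one₀ hx.1 hx.2))]

/-- By `integrand_inv`, `S t⁻¹ + S t` has derivative zero; its constant value is read off at `t =
1`. -/
theorem schwarzMap_inv {t : ℂ} (ht : t ∈ sector) : schwarzMap t⁻¹ = 2 * K - schwarzMap t := by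
  have h1 : (1 : ℂ) ∈ sector := by simp [sector]
  have hder : ∀ w ∈ sector, HasDerivAt (fun w => schwarzMap w⁻¹ + schwarzMap w) 0 w := by
    intro w hw
    have hw0 := sector_ne_zero hw
    have h := ((hasDerivAt_schwarzMap (sector_subset_slitDomain (inv_mem_sector hw))).comp w
      (hasDerivAt_inv hw0)).add (hasDerivAt_schwarzMap (sector_subset_slitDomain hw))
    refine h.congr_deriv ?_
    rw [integrand_inv hw]
    field_simp
    ring
  have hconst := isOpen_sector.is_const_of_deriv_eq_zero
    convex_sector.isPreconnected
    (fun w hw => (hder w hw).differentiableAt.differentiableWithinAt)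
    (fun w hw => (hder w hw).deriv) ht h1
  simp only [inv_one, schwarzMap_one] at hconst
  linear_combination hconst

/-! ### The arc `|arg t| ≤ π / 6` of the unit circle -/

theorem exp_mul_I_mem_sector {θ : ℝ} (hθ : θ ∈ Ioo (-(Real.pi / 6)) (Real.pi / 6)) :
    exp (θ * I) ∈ sector := by
  rw [mem_sector_iff, ← exp_nat_mul, show ((3 : ℕ) : ℂ) * (θ * I) = ((3 * θ : ℝ) : ℂ) * I by
    push_cast; ring, exp_ofReal_mul_I_re, exp_ofReal_mul_I_re]
  constructor <;> refine Real.cos_pos_of_mem_Ioo ⟨?_, ?_⟩ <;> linarith [hθ.1, hθ.2, Real.pi_pos]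

/-- On the circle `t⁻¹` is the conjugate of `t`, so `integrand_inv` makes the product real. Its sign
comes from its cube, the reciprocal of `t³ + t⁻³ = 2 re (t³)`. Thus the image of the arc moves
straight upwards. -/
theorem exists_pos_mul_integrand_eq {t : ℂ} (ht : t ∈ sector) (hn : ‖t‖ = 1) :
    ∃ ρ : ℝ, 0 < ρ ∧ t * integrand t = ρ := by
  have ht0 := sector_ne_zero ht
  have hconj : (starRingEnd ℂ) t = t⁻¹ := (inv_eq_conj hn).symm
  have hslit := sector_subset_slitDomain ht
  have hne := one_add_ne_zero_of_mem_slitDomain hslit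
  have hi : (starRingEnd ℂ) (integrand t) = integrand t⁻¹ := by
    have h := conj_cpow (1 + t ^ 6) (-(1 / 3)) (mem_slitPlane_iff_arg.1 hslit).1
    rw [integrand, integrand, ← hconj]
    have e : (starRingEnd ℂ) (-(1 / 3) : ℂ) = -(1 / 3) := by simp [conj_ofNat]
    rw [e] at h
    rw [← h, map_add, map_one, map_pow]
  have hreal : (starRingEnd ℂ) (t * integrand t) = t * integrand t := by
    rw [map_mul, hi, hconj, integrand_inv ht]
    field_simp
  obtain ⟨ρ, hρ⟩ := conj_eq_iff_real.1 hreal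
  refine ⟨ρ, ?_, hρ⟩
  have h3 : (ρ : ℂ) ^ 3 * (t ^ 3 + (starRingEnd ℂ) (t ^ 3)) = 1 := by
    rw [← hρ, mul_pow, integrand_pow_three, map_pow, hconj]
    field_simp
    ring
  rw [add_conj] at h3
  have h4 : ρ ^ 3 * (2 * (t ^ 3).re) = 1 := by exact_mod_cast h3
  have h5 := (mem_sector_iff.1 ht).2
  have h6 : 0 < ρ ^ 3 := by
    by_contra hcon
    nlinarith
  by_contra hcon
  have : ρ ^ 3 ≤ 0 := by
    have := pow_nonneg (neg_nonneg.2 (not_lt.1 hcon)) 3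
    nlinarith
  linarith

theorem hasDerivAt_schwarzMap_arc {θ : ℝ} (hθ : θ ∈ Ioo (-(Real.pi / 6)) (Real.pi / 6)) :
    ∃ ρ : ℝ, 0 < ρ ∧ HasDerivAt (fun θ : ℝ => schwarzMap (exp (θ * I))) (ρ * I) θ := by
  have hs := exp_mul_I_mem_sector hθ
  obtain ⟨ρ, hρ, h⟩ := exists_pos_mul_integrand_eq hs (norm_exp_ofReal_mul_I θ)
  refine ⟨ρ, hρ, ?_⟩
  have h3 : HasDerivAt (fun x : ℝ => (x : ℂ)) 1 θ := ofRealCLM.hasDerivAt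
  have h4 := HasDerivAt.comp_of_eq θ (hasDerivAt_schwarzMap (sector_subset_slitDomain hs))
    (h3.mul_const I).cexp rfl
  refine h4.congr_deriv ?_
  rw [← h]
  ring

theorem continuousOn_schwarzMap_arc :
    ContinuousOn (fun θ : ℝ => schwarzMap (exp (θ * I))) (Icc (-(Real.pi / 6)) (Real.pi / 6)) := by
  refine continuousOn_schwarzMap.comp (f := fun θ : ℝ => exp (θ * I)) (by fun_prop) ?_
  intro θ _
  simp [norm_exp_ofReal_mul_I]

theorem re_schwarzMap_arc {θ : ℝ} (hθ : θ ∈ Icc (-(Real.pi / 6)) (Real.pi / 6)) :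
    (schwarzMap (exp (θ * I))).re = K := by
  have hpi := Real.pi_pos
  have hcont : ContinuousOn (fun θ : ℝ => (schwarzMap (exp (θ * I))).re)
      (Icc (-(Real.pi / 6)) (Real.pi / 6)) :=
    continuous_re.comp_continuousOn continuousOn_schwarzMap_arc
  have hder : ∀ θ ∈ interior (Icc (-(Real.pi / 6)) (Real.pi / 6)),
      HasDerivAt (fun θ : ℝ => (schwarzMap (exp (θ * I))).re) 0 θ := by
    intro θ hθ
    rw [interior_Icc] at hθ
    obtain ⟨ρ, _, h⟩ := hasDerivAt_schwarzMap_arc hθ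
    refine (reCLM.hasFDerivAt.comp_hasDerivAt θ h).congr_deriv ?_
    simp
  have hdiff : DifferentiableOn ℝ (fun θ : ℝ => (schwarzMap (exp (θ * I))).re)
      (interior (Icc (-(Real.pi / 6)) (Real.pi / 6))) := fun θ hθ =>
    (hder θ hθ).differentiableAt.differentiableWithinAt
  have hmono := monotoneOn_of_deriv_nonneg (convex_Icc _ _) hcont hdiff
    fun θ hθ => (hder θ hθ).deriv.ge
  have hanti := antitoneOn_of_deriv_nonpos (convex_Icc _ _) hcont hdiff
    fun θ hθ => (hder θ hθ).deriv.le
  have h0 : (0 : ℝ) ∈ Icc (-(Real.pi / 6)) (Real.pi / 6) := by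
    constructor <;> linarith
  have hK : (schwarzMap (exp ((0 : ℝ) * I))).re = K := by simp [schwarzMap_one]
  rw [← hK]
  rcases le_total θ 0 with h | h
  · exact le_antisymm (hmono hθ h0 h) (hanti hθ h0 h)
  · exact le_antisymm (hanti h0 hθ h) (hmono h0 hθ h)

theorem strictMonoOn_im_schwarzMap_arc :
    StrictMonoOn (fun θ : ℝ => (schwarzMap (exp (θ * I))).im)
      (Icc (-(Real.pi / 6)) (Real.pi / 6)) := by
  refine strictMonoOn_of_deriv_pos (convex_Icc _ _)
    (continuous_im.comp_continuousOn continuousOn_schwarzMap_arc) fun θ hθ => ?_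
  rw [interior_Icc] at hθ
  obtain ⟨ρ, hρ, h⟩ := hasDerivAt_schwarzMap_arc hθ
  have h' : HasDerivAt (fun θ : ℝ => (schwarzMap (exp (θ * I))).im) ρ θ := by
    refine (imCLM.hasFDerivAt.comp_hasDerivAt θ h).congr_deriv ?_
    simp
  rwa [h'.deriv]

/-! ### Geometry of the hexagon -/

/-- The closed hexagon with vertices `δ L γ ^ k`, two of whose edges are vertical. -/
noncomputable def closedHexagon : Set ℂ :=
  convexHull ℝ (range fun k : Fin 6 => δ * ((L : ℂ) * γ ^ (k : ℕ)))

theorem δ_eq : δ = ⟨√3 / 2, 1 / 2⟩ := by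
  rw [δ, show I * Real.pi / 6 = ((Real.pi / 6 : ℝ) : ℂ) * I by push_cast; ring]
  apply Complex.ext
  · rw [exp_ofReal_mul_I_re, Real.cos_pi_div_six]
  · rw [exp_ofReal_mul_I_im, Real.sin_pi_div_six]

theorem γ_eq : γ = ⟨1 / 2, √3 / 2⟩ := by
  rw [γ, show I * Real.pi / 3 = ((Real.pi / 3 : ℝ) : ℂ) * I by push_cast; ring]
  apply Complex.ext
  · rw [exp_ofReal_mul_I_re, Real.cos_pi_div_three]
  · rw [exp_ofReal_mul_I_im, Real.sin_pi_div_three]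

theorem δ_sq : δ ^ 2 = γ := by
  rw [δ, γ, ← exp_nat_mul]
  congr 1
  push_cast
  ring

theorem δ_ne_zero : δ ≠ 0 := exp_ne_zero _

theorem γ_ne_zero : γ ≠ 0 := exp_ne_zero _

theorem norm_γ : ‖γ‖ = 1 := by
  rw [γ, show I * Real.pi / 3 = ((Real.pi / 3 : ℝ) : ℂ) * I by push_cast; ring,
    norm_exp_ofReal_mul_I]

/-- A crude bound, enough for the disc of radius `4 ^ 4 / 5 ^ 5` to lie within the disc of radius
`K`. -/
theorem half_le_K : 1 / 2 ≤ K := by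
  have hcont : ContinuousOn (fun x : ℝ => 1 / (1 + x ^ 6) ^ (1 / 3 : ℝ)) (uIcc 0 1) := by
    refine ContinuousOn.div continuousOn_const (ContinuousOn.rpow_const (by fun_prop) ?_) ?_
    · intro x _
      right
      norm_num
    · intro x _
      positivity
  have h := intervalIntegral.integral_mono_on (a := 0) (b := 1) (μ := MeasureTheory.volume)
    zero_le_one (f := fun _ => (1 / 2 : ℝ)) (g := fun x : ℝ => 1 / (1 + x ^ 6) ^ (1 / 3 : ℝ))
    (by simp) hcont.intervalIntegrable (fun x hx => by
      have h1 : 1 + x ^ 6 ≤ 2 := by linarith [pow_le_one₀ (n := 6) hx.1 hx.2]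
      have h2 : (1 + x ^ 6) ^ (1 / 3 : ℝ) ≤ 1 + x ^ 6 :=
        Real.rpow_le_self_of_one_le (by linarith [pow_nonneg hx.1 6]) (by norm_num)
      exact one_div_le_one_div_of_le (by positivity) (h2.trans h1))
  simpa [K] using h

theorem K_pos : 0 < K := by linarith [half_le_K]

/-- The endpoint `δ` of the arc has image `δ L`, whose real part must be `K`. -/
theorem K_eq : K = √3 / 2 * L := by
  have h := re_schwarzMap_arc (θ := Real.pi / 6)
    (right_mem_Icc.2 (by linarith [Real.pi_pos]))
  rw [show ((Real.pi / 6 : ℝ) : ℂ) * I = I * Real.pi / 6 by push_cast; ring, ← δ, schwarzMap_δ,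
    re_mul_ofReal, δ_eq] at h
  exact h.symm

theorem L_pos : 0 < L := by
  have h := K_pos
  rw [K_eq] at h
  exact pos_of_mul_pos_right h (by positivity)

theorem mem_hexagonAt_iff {n : ℤ} {z : ℂ} :
    z ∈ hexagonAt n ↔ z - 2 * n * K ∈ interior closedHexagon := by
  have h1 : (fun z => δ * z) '' hexagon = interior closedHexagon := by
    have h2 := (Homeomorph.mulLeft₀ δ δ_ne_zero).image_interior
      (convexHull ℝ (range fun k : Fin 6 => (L : ℂ) * γ ^ (k : ℕ)))
    have h3 := (LinearMap.mulLeft ℝ δ).image_convexHull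
      (range fun k : Fin 6 => (L : ℂ) * γ ^ (k : ℕ))
    rw [← range_comp] at h3
    rw [closedHexagon, hexagon]
    exact h2.trans (congrArg interior h3)
  rw [← h1, hexagonAt]
  constructor
  · rintro ⟨w, hw, rfl⟩
    exact ⟨w, hw, by ring⟩
  · rintro ⟨w, hw, h⟩
    exact ⟨w, hw, by simp only [h]; ring⟩

theorem convex_closedHexagon : Convex ℝ closedHexagon := convex_convexHull ℝ _

theorem isCompact_closedHexagon : IsCompact closedHexagon :=
  (finite_range _).isCompact_convexHull ℝ

theorem γ_mul_mem_closedHexagon {z : ℂ} (hz : z ∈ closedHexagon) : γ * z ∈ closedHexagon := by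
  have hconv : Convex ℝ {z : ℂ | γ * z ∈ closedHexagon} :=
    convex_closedHexagon.linear_preimage (LinearMap.mulLeft ℝ γ)
  refine convexHull_min ?_ hconv hz
  rintro _ ⟨k, rfl⟩
  refine subset_convexHull ℝ _ ⟨k + 1, ?_⟩
  -- Addition in `Fin 6` wraps around, which is harmless because the order of `γ` divides `6`.
  have h : γ ^ ((k + 1 : Fin 6) : ℕ) = γ ^ ((k : ℕ) + 1) := by
    rw [Fin.val_add, Fin.val_one, ← pow_mod_orderOf γ ((k : ℕ) + 1), ← pow_mod_orderOf,
      Nat.mod_mod_of_dvd _ (orderOf_dvd_of_pow_eq_one γ_pow_six)]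
  simp only [h]
  ring

theorem γ_pow_mul_mem_closedHexagon {z : ℂ} (hz : z ∈ closedHexagon) (k : ℕ) :
    γ ^ k * z ∈ closedHexagon := by
  induction k with
  | zero => simpa
  | succ k ih =>
    rw [pow_succ', mul_assoc]
    exact γ_mul_mem_closedHexagon ih

theorem δ_mul_L_mem_closedHexagon : δ * L ∈ closedHexagon :=
  subset_convexHull ℝ _ ⟨0, by simp⟩

theorem re_le_of_mem_closedHexagon {z : ℂ} (hz : z ∈ closedHexagon) : z.re ≤ K := by
  refine convexHull_min (t := {z : ℂ | z.re ≤ K}) ?_ (convex_halfSpace_re_le K) hz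
  rintro _ ⟨k, rfl⟩
  have h3 : √3 * √3 = 3 := Real.mul_self_sqrt (by norm_num)
  have hp := mul_pos (Real.sqrt_pos.2 (show (0 : ℝ) < 3 by norm_num)) L_pos
  have e0 : (δ * ((L : ℂ) * γ ^ 0)).re = K := by
    rw [δ_eq, K_eq]
    simp
  have e1 : (δ * ((L : ℂ) * γ ^ 1)).re = 0 := by
    rw [δ_eq, γ_eq]
    simp
    ring
  have e2 : (δ * ((L : ℂ) * γ ^ 2)).re = -K := by
    rw [δ_eq, γ_eq, K_eq, sq]
    simp
    linear_combination (-(√3 * L / 8)) * h3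
  have e3 : ∀ k : ℕ, (δ * ((L : ℂ) * γ ^ (k + 3))).re = -(δ * ((L : ℂ) * γ ^ k)).re := by
    intro k
    rw [pow_add, γ_pow_three, ← neg_re]
    congr 1
    ring
  have hK := K_pos
  show (δ * ((L : ℂ) * γ ^ (k : ℕ))).re ≤ K
  fin_cases k
  · exact e0.le
  · exact e1.le.trans hK.le
  · exact e2.le.trans (by linarith)
  · exact (e3 0).le.trans (by linarith)
  · exact (e3 1).le.trans (by linarith)
  · exact (e3 2).le.trans (by linarith)

theorem γ_pow_five : γ ^ 5 = ⟨1 / 2, -(√3 / 2)⟩ := by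
  have h : γ ^ 5 = (starRingEnd ℂ) γ := by
    rw [← inv_eq_conj norm_γ]
    refine eq_inv_of_mul_eq_one_left ?_
    rw [← pow_succ, γ_pow_six]
  rw [h, γ_eq]
  rfl

/-- The half-plane `re ≤ K`, pulled back by the rotations `γ ^ 5` and `γ ^ 4`, bounds the two upper
slanted edges. -/
theorem im_le_of_mem_closedHexagon {z : ℂ} (hz : z ∈ closedHexagon) :
    √3 * z.im + |z.re| ≤ √3 * L := by
  have h1 := re_le_of_mem_closedHexagon (γ_pow_mul_mem_closedHexagon hz 5)
  have h2 := re_le_of_mem_closedHexagon (γ_pow_mul_mem_closedHexagon hz 4)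
  have h4 : γ ^ 4 = -γ := by rw [pow_succ, γ_pow_three]; ring
  rw [γ_pow_five, mul_re, K_eq] at h1
  rw [h4, γ_eq, mul_re, neg_re, neg_im, K_eq] at h2
  dsimp only at h1 h2
  rcases abs_cases z.re with ⟨h, _⟩ | ⟨h, _⟩ <;> rw [h] <;> linarith

theorem neg_mem_closedHexagon {z : ℂ} (hz : z ∈ closedHexagon) : -z ∈ closedHexagon := by
  have := γ_pow_mul_mem_closedHexagon hz 3
  rwa [γ_pow_three, neg_one_mul] at this

theorem γ_pow_five_mul_δ : γ ^ 5 * δ = δ⁻¹ := by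
  refine eq_inv_of_mul_eq_one_left ?_
  rw [mul_assoc, ← sq, δ_sq, ← pow_succ, γ_pow_six]

theorem L_mul_δ : (L * δ : ℂ) = ⟨K, L / 2⟩ := by
  rw [δ_eq, K_eq]
  apply Complex.ext <;> simp <;> ring

theorem L_mul_δ_inv : (L * δ⁻¹ : ℂ) = ⟨K, -(L / 2)⟩ := by
  have h3 : √3 * √3 = 3 := Real.mul_self_sqrt (by norm_num)
  rw [← γ_pow_five_mul_δ, mul_comm (γ ^ 5), ← mul_assoc, L_mul_δ, γ_pow_five, K_eq]
  apply Complex.ext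
  · rw [mul_re]
    ring
  · rw [mul_im]
    linear_combination (-(L / 4)) * h3

theorem mem_openSegment_vertices_iff {z : ℂ} :
    z ∈ openSegment ℝ (L * δ⁻¹ : ℂ) (L * δ) ↔ z.re = K ∧ |z.im| < L / 2 := by
  have hL := L_pos
  rw [L_mul_δ, L_mul_δ_inv, openSegment_eq_image]
  constructor
  · rintro ⟨x, ⟨hx0, hx1⟩, rfl⟩
    simp only [add_re, add_im, smul_re, smul_im, smul_eq_mul]
    exact ⟨by ring, abs_lt.2 ⟨by nlinarith, by nlinarith⟩⟩
  · rintro ⟨h1, h2⟩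
    rw [abs_lt] at h2
    refine ⟨(z.im + L / 2) / L, ⟨div_pos (by linarith) hL, (div_lt_one hL).2 (by linarith)⟩, ?_⟩
    apply Complex.ext
    · simp only [add_re, smul_re, smul_eq_mul, h1]
      ring
    · simp only [add_im, smul_im, smul_eq_mul]
      field_simp
      ring

theorem mem_closedHexagon_of_re_eq {z : ℂ} (h1 : z.re = K) (h2 : |z.im| ≤ L / 2) :
    z ∈ closedHexagon := by
  have hL := L_pos
  have hv1 : (⟨K, L / 2⟩ : ℂ) ∈ closedHexagon := by
    rw [← L_mul_δ, mul_comm]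
    exact δ_mul_L_mem_closedHexagon
  have hv2 : (⟨K, -(L / 2)⟩ : ℂ) ∈ closedHexagon := by
    rw [← L_mul_δ_inv, ← γ_pow_five_mul_δ, mul_comm, mul_assoc]
    exact γ_pow_mul_mem_closedHexagon δ_mul_L_mem_closedHexagon 5
  rw [abs_le] at h2
  convert convex_closedHexagon hv2 hv1 (a := (L / 2 - z.im) / L) (b := (z.im + L / 2) / L)
    (div_nonneg (by linarith) hL.le) (div_nonneg (by linarith) hL.le)
    (by field_simp; ring) using 1
  apply Complex.ext
  · simp only [add_re, smul_re, smul_eq_mul, h1]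
    field_simp
    ring
  · simp only [add_im, smul_im, smul_eq_mul]
    field_simp
    ring

/-! ### The image of the unit circle -/

theorem schwarzMap_exp_pi_div_six : (schwarzMap (exp ((Real.pi / 6 : ℝ) * I))).im = L / 2 := by
  rw [show ((Real.pi / 6 : ℝ) : ℂ) * I = I * Real.pi / 6 by push_cast; ring, ← δ, schwarzMap_δ,
    mul_comm, L_mul_δ]

theorem schwarzMap_exp_neg_pi_div_six :
    (schwarzMap (exp ((-(Real.pi / 6) : ℝ) * I))).im = -(L / 2) := by
  have h : exp ((-(Real.pi / 6) : ℝ) * I) = γ ^ 5 * δ := by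
    rw [γ_pow_five_mul_δ, δ, ← exp_neg]
    congr 1
    push_cast
    ring
  rw [h, schwarzMap_mul (by rw [← pow_mul, mul_comm, pow_mul, γ_pow_six, one_pow]), schwarzMap_δ,
    ← mul_assoc, γ_pow_five_mul_δ, mul_comm, L_mul_δ_inv]

theorem abs_im_schwarzMap_arc {θ : ℝ} (hθ : θ ∈ Icc (-(Real.pi / 6)) (Real.pi / 6)) :
    |(schwarzMap (exp (θ * I))).im| ≤ L / 2 := by
  have hpi := Real.pi_pos
  have hmono := strictMonoOn_im_schwarzMap_arc.monotoneOn
  have h1 := hmono hθ (right_mem_Icc.2 (by linarith)) hθ.2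
  have h2 := hmono (left_mem_Icc.2 (by linarith)) hθ hθ.1
  simp only [schwarzMap_exp_pi_div_six, schwarzMap_exp_neg_pi_div_six] at h1 h2
  exact abs_le.2 ⟨h2, h1⟩

theorem exists_schwarzMap_arc_eq {z : ℂ} (h1 : z.re = K) (h2 : |z.im| < L / 2) :
    ∃ θ ∈ Ioo (-(Real.pi / 6)) (Real.pi / 6), schwarzMap (exp (θ * I)) = z := by
  have h := intermediate_value_Ioo (by linarith [Real.pi_pos])
    (continuous_im.comp_continuousOn continuousOn_schwarzMap_arc)
  simp only [Function.comp, schwarzMap_exp_pi_div_six, schwarzMap_exp_neg_pi_div_six] at h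
  obtain ⟨θ, hθ, he⟩ := h (abs_lt.1 h2)
  refine ⟨θ, hθ, Complex.ext ?_ he⟩
  rw [re_schwarzMap_arc (Ioo_subset_Icc_self hθ), h1]

theorem exists_eq_γ_pow_mul_exp {t : ℂ} (ht : ‖t‖ = 1) :
    ∃ (k : ℕ) (θ : ℝ), θ ∈ Icc (-(Real.pi / 6)) (Real.pi / 6) ∧ t = γ ^ k * exp (θ * I) := by
  have hpi := Real.pi_pos
  -- This choice of argument is positive, so the index of the nearest multiple of `π / 3` is a
  -- natural number.
  set α := arg (-t) + Real.pi with hα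
  have hα0 : 0 < α := by linarith [neg_pi_lt_arg (-t)]
  have ht' : t = exp (α * I) := by
    have h := norm_mul_exp_arg_mul_I (-t)
    rw [norm_neg, ht, ofReal_one, one_mul] at h
    rw [hα, ofReal_add, add_mul, exp_add, h, exp_pi_mul_I]
    ring
  refine ⟨⌊α / (Real.pi / 3) + 1 / 2⌋₊, α - ⌊α / (Real.pi / 3) + 1 / 2⌋₊ * (Real.pi / 3), ?_, ?_⟩
  · have hα' : α = α / (Real.pi / 3) * (Real.pi / 3) := by field_simp
    have h1 := Nat.floor_le (show 0 ≤ α / (Real.pi / 3) + 1 / 2 by positivity)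
    have h2 := Nat.lt_floor_add_one (α / (Real.pi / 3) + 1 / 2)
    constructor <;> nlinarith
  · rw [γ, ← exp_nat_mul, ← exp_add, ht']
    congr 1
    push_cast
    ring

theorem schwarzMap_mem_of_norm_eq_one {t : ℂ} (ht : ‖t‖ = 1) :
    schwarzMap t ∈ closedHexagon ∧ ∃ k : ℕ, (γ ^ k * schwarzMap t).re = K := by
  obtain ⟨k, θ, hθ, rfl⟩ := exists_eq_γ_pow_mul_exp ht
  have h6 : (γ ^ k) ^ 6 = 1 := by rw [← pow_mul, mul_comm, pow_mul, γ_pow_six, one_pow]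
  rw [schwarzMap_mul h6]
  refine ⟨γ_pow_mul_mem_closedHexagon
    (mem_closedHexagon_of_re_eq (re_schwarzMap_arc hθ) (abs_im_schwarzMap_arc hθ)) k, 5 * k, ?_⟩
  rw [← mul_assoc, ← pow_add, show 5 * k + k = 6 * k by ring, pow_mul, γ_pow_six, one_pow, one_mul,
    re_schwarzMap_arc hθ]

/-! ### The image of the unit disc -/

/-- A point outside would be separated from the hexagon by a real functional `z ↦ re (a z)`. Then
`exp (a S)` would be larger in modulus there than its bound on the unit circle, against the maximum
principle. -/
theorem schwarzMap_mem_closedHexagon {t : ℂ} (ht : ‖t‖ < 1) : schwarzMap t ∈ closedHexagon := by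
  by_contra hcon
  obtain ⟨f, u, hf, hu⟩ := geometric_hahn_banach_closed_point convex_closedHexagon
    isCompact_closedHexagon.isClosed hcon
  set a : ℂ := ⟨f 1, -f I⟩ with ha
  have hfa : ∀ z : ℂ, f z = (a * z).re := by
    intro z
    have hz : z = z.re • (1 : ℂ) + z.im • I := by
      simp [re_add_im]
    conv_lhs => rw [hz]
    rw [map_add, map_smul, map_smul, mul_re, ha]
    simp only [smul_eq_mul]
    ring
  have hd : DiffContOnCl ℂ (fun t => exp (a * schwarzMap t)) (Metric.ball 0 1) := by
    refine ⟨fun w hw => ?_, ?_⟩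
    · have := hasDerivAt_schwarzMap (mem_slitDomain_of_norm_lt_one (by simpa using hw))
      exact (this.differentiableAt.const_mul a).cexp.differentiableWithinAt
    · rw [closure_ball _ one_ne_zero]
      exact (continuousOn_const.mul continuousOn_schwarzMap).cexp
  have hbound := norm_le_of_forall_mem_frontier_norm_le Metric.isBounded_ball hd
    (C := Real.exp u) (fun w hw => by
      rw [frontier_ball _ one_ne_zero] at hw
      rw [norm_exp, ← hfa]
      exact Real.exp_le_exp.2 (hf _ (schwarzMap_mem_of_norm_eq_one (by simpa using hw)).1).le)
    (subset_closure (show t ∈ Metric.ball 0 1 by simpa using ht))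
  rw [norm_exp, ← hfa, Real.exp_le_exp] at hbound
  linarith

theorem hasStrictDerivAt_schwarzMap {t : ℂ} (ht : t ∈ slitDomain) :
    HasStrictDerivAt schwarzMap (integrand t) t := by
  have hd : DifferentiableOn ℂ schwarzMap slitDomain := fun w hw =>
    (hasDerivAt_schwarzMap hw).differentiableAt.differentiableWithinAt
  have h := (hd.analyticAt (isOpen_slitDomain.mem_nhds ht)).hasStrictDerivAt
  rwa [(hasDerivAt_schwarzMap ht).deriv] at h

theorem isOpen_image_schwarzMap {U : Set ℂ} (hU : IsOpen U) (hsub : U ⊆ slitDomain) :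
    IsOpen (schwarzMap '' U) := by
  rw [isOpen_iff_mem_nhds]
  rintro _ ⟨t, ht, rfl⟩
  rw [← (hasStrictDerivAt_schwarzMap (hsub ht)).map_nhds_eq
    (integrand_ne_zero (one_add_ne_zero_of_mem_slitDomain (hsub ht)))]
  exact image_mem_map (hU.mem_nhds ht)

theorem ball_subset_slitDomain : Metric.ball 0 1 ⊆ slitDomain := fun t ht =>
  mem_slitDomain_of_norm_lt_one (by simpa using ht)

theorem schwarzMap_mem_interior {t : ℂ} (ht : ‖t‖ < 1) :
    schwarzMap t ∈ interior closedHexagon := by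
  refine interior_maximal ?_ (isOpen_image_schwarzMap Metric.isOpen_ball ball_subset_slitDomain)
    (mem_image_of_mem _ (show t ∈ Metric.ball 0 1 by simpa using ht))
  rintro _ ⟨w, hw, rfl⟩
  exact schwarzMap_mem_closedHexagon (by simpa using hw)

/-- The open image of the disc and the complement of the compact image of the closed disc are
disjoint. They cover `A` because the circle's image avoids it, and `A` meets the first at `0`. -/
theorem subset_image_schwarzMap {A : Set ℂ} (hA : IsPreconnected A) (h0 : (0 : ℂ) ∈ A)
    (hdisj : ∀ t : ℂ, ‖t‖ = 1 → schwarzMap t ∉ A) : A ⊆ schwarzMap '' Metric.ball 0 1 := by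
  have hcomp : IsClosed (schwarzMap '' Metric.closedBall 0 1) :=
    ((isCompact_closedBall 0 1).image_of_continuousOn continuousOn_schwarzMap).isClosed
  refine hA.subset_left_of_subset_union
    (isOpen_image_schwarzMap Metric.isOpen_ball ball_subset_slitDomain) hcomp.isOpen_compl
    (disjoint_compl_right.mono_left (image_mono Metric.ball_subset_closedBall)) ?_
    ⟨0, h0, 0, by simp, schwarzMap_zero⟩
  intro z hz
  by_cases h : z ∈ schwarzMap '' Metric.closedBall 0 1
  · obtain ⟨t, ht, rfl⟩ := h
    left
    refine mem_image_of_mem _ ?_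
    rw [mem_closedBall_zero_iff] at ht
    rw [mem_ball_zero_iff]
    exact lt_of_le_of_ne ht fun h => hdisj t h hz
  · exact Or.inr h

theorem re_lt_of_mem_interior {z : ℂ} (hz : z ∈ interior closedHexagon) : z.re < K := by
  have hsub : closedHexagon ⊆ {w | w.re ≤ K} := fun w hw => re_le_of_mem_closedHexagon hw
  have := interior_mono hsub hz
  rwa [interior_setOfPred_re_le] at this

theorem neg_mem_interior {z : ℂ} (hz : z ∈ interior closedHexagon) :
    -z ∈ interior closedHexagon := by
  have h := (Homeomorph.neg ℂ).preimage_interior closedHexagon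
  have h2 : (Homeomorph.neg ℂ) ⁻¹' closedHexagon = closedHexagon := by
    ext w
    exact ⟨fun hw => by simpa using neg_mem_closedHexagon hw, neg_mem_closedHexagon⟩
  rw [h2] at h
  rw [← h] at hz
  exact hz

theorem abs_re_lt_of_mem_interior {z : ℂ} (hz : z ∈ interior closedHexagon) : |z.re| < K :=
  abs_lt.2 ⟨by linarith [re_lt_of_mem_interior (neg_mem_interior hz), neg_re z],
    re_lt_of_mem_interior hz⟩

theorem zero_mem_interior : (0 : ℂ) ∈ interior closedHexagon := by
  simpa [schwarzMap_zero] using schwarzMap_mem_interior (t := 0) (by simp)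

theorem interior_subset_image_schwarzMap :
    interior closedHexagon ⊆ schwarzMap '' Metric.ball 0 1 := by
  refine subset_image_schwarzMap convex_closedHexagon.interior.isPreconnected
    zero_mem_interior fun t ht hmem => ?_
  obtain ⟨k, hk⟩ := (schwarzMap_mem_of_norm_eq_one ht).2
  have hrot : ∀ k : ℕ, γ ^ k * schwarzMap t ∈ interior closedHexagon := by
    intro k
    have hk0 : γ ^ k ≠ 0 := pow_ne_zero k γ_ne_zero
    have h := mem_image_of_mem (Homeomorph.mulLeft₀ (γ ^ k) hk0) hmem
    rw [(Homeomorph.mulLeft₀ (γ ^ k) hk0).image_interior] at h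
    refine interior_mono ?_ h
    rintro _ ⟨w, hw, rfl⟩
    exact γ_pow_mul_mem_closedHexagon hw k
  exact (re_lt_of_mem_interior (hrot k)).ne hk

theorem ball_subset_image_schwarzMap : Metric.ball 0 K ⊆ schwarzMap '' Metric.ball 0 1 := by
  refine subset_image_schwarzMap (convex_ball 0 K).isPreconnected
    (Metric.mem_ball_self K_pos) fun t ht hmem => ?_
  obtain ⟨k, hk⟩ := (schwarzMap_mem_of_norm_eq_one ht).2
  have h := (le_abs_self _).trans (abs_re_le_norm (γ ^ k * schwarzMap t))
  rw [hk, norm_mul, norm_pow, norm_γ, one_pow, one_mul] at h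
  rw [mem_ball_zero_iff] at hmem
  linarith

/-! ### The inverse of the Schwarz–Christoffel map -/

theorem re_schwarzMap_lt {t : ℂ} (ht : ‖t‖ < 1) : (schwarzMap t).re < K :=
  re_lt_of_mem_interior (schwarzMap_mem_interior ht)

theorem re_schwarzMap_eq {t : ℂ} (hs : t ∈ sector) (ht : ‖t‖ = 1) : (schwarzMap t).re = K := by
  have h3 := (mem_sector_iff.1 hs).2
  have harg := abs_lt.1 (abs_arg_lt_pi_div_two_iff.2 (Or.inl h3))
  have h : t = exp (((t ^ 3).arg / 3 : ℝ) * I) := by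
    conv_lhs => rw [← exp_third_log_pow_three hs]
    congr 1
    rw [Complex.log, norm_pow, ht]
    push_cast
    simp
    ring
  rw [h]
  exact re_schwarzMap_arc ⟨by linarith [harg.1], by linarith [harg.2]⟩

theorem lt_re_schwarzMap {t : ℂ} (hs : t ∈ sector) (ht : 1 < ‖t‖) : K < (schwarzMap t).re := by
  have h := congrArg re (schwarzMap_inv hs)
  have h' := re_schwarzMap_lt (t := t⁻¹) (by rw [norm_inv]; exact inv_lt_one_of_one_lt₀ ht)
  have e : ((2 * K - schwarzMap t : ℂ)).re = 2 * K - (schwarzMap t).re := by simp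
  rw [e] at h
  linarith

/-- The union of the unit disc and the sector, which the Schwarz–Christoffel map takes
injectively onto a neighbourhood of the hexagon along with its open right-hand edge. -/
def discSector : Set ℂ := Metric.ball 0 1 ∪ sector

theorem discSector_subset_slitDomain : discSector ⊆ slitDomain :=
  union_subset ball_subset_slitDomain sector_subset_slitDomain

theorem isOpen_discSector : IsOpen discSector := Metric.isOpen_ball.union isOpen_sector

theorem one_add_ne_zero {t : ℂ} (ht : t ∈ discSector) : 1 + t ^ 6 ≠ 0 :=
  one_add_ne_zero_of_mem_slitDomain (discSector_subset_slitDomain ht)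

/-- Disc and sector are convex, but their union is not. For a mixed pair, `re S < K` on the disc
while `re S ≥ K` on the rest of the sector. -/
theorem injOn_schwarzMap : InjOn schwarzMap discSector := by
  have hinj : ∀ {A : Set ℂ}, Convex ℝ A → A ⊆ slitDomain → InjOn schwarzMap A := fun hA hsub =>
    injOn_of_re_deriv_pos hA (fun z hz => hasDerivAt_schwarzMap (hsub hz))
      fun z hz => re_integrand_pos (one_add_ne_zero_of_mem_slitDomain (hsub hz))
  have hmixed : ∀ {a b : ℂ}, ‖a‖ < 1 → b ∈ sector → schwarzMap a = schwarzMap b → a = b := by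
    intro a b ha hb h
    by_cases hb1 : ‖b‖ < 1
    · exact hinj (convex_ball 0 1) ball_subset_slitDomain (by simpa using ha) (by simpa using hb1) h
    · have h1 := re_schwarzMap_lt ha
      have h2 : K ≤ (schwarzMap b).re := by
        rcases (not_lt.1 hb1).eq_or_lt with h | h
        · exact (re_schwarzMap_eq hb h.symm).ge
        · exact (lt_re_schwarzMap hb h).le
      rw [h] at h1
      linarith
  rintro a (ha | ha) b (hb | hb) h
  · exact hinj (convex_ball 0 1) ball_subset_slitDomain ha hb h
  · exact hmixed (by simpa using ha) hb h
  · exact (hmixed (by simpa using hb) ha h.symm).symm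
  · exact hinj convex_sector sector_subset_slitDomain ha hb h

/-- The inverse of the Schwarz–Christoffel map; it continues `s / c`. -/
noncomputable def schwarzInv : ℂ → ℂ := Function.invFunOn schwarzMap discSector

theorem schwarzInv_schwarzMap {t : ℂ} (ht : t ∈ discSector) : schwarzInv (schwarzMap t) = t :=
  injOn_schwarzMap.leftInvOn_invFunOn ht

theorem hasDerivAt_schwarzInv {t : ℂ} (ht : t ∈ discSector) :
    HasDerivAt schwarzInv (integrand t)⁻¹ (schwarzMap t) :=
  ((hasStrictDerivAt_schwarzMap (discSector_subset_slitDomain ht)).to_local_left_inverse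
    (integrand_ne_zero (one_add_ne_zero ht))
    (eventually_of_mem (isOpen_discSector.mem_nhds ht)
      fun _ h => schwarzInv_schwarzMap h)).hasDerivAt

theorem analyticAt_schwarzInv {t : ℂ} (ht : t ∈ discSector) :
    AnalyticAt ℂ schwarzInv (schwarzMap t) := by
  have hd : DifferentiableOn ℂ schwarzInv (schwarzMap '' discSector) := by
    rintro _ ⟨w, hw, rfl⟩
    exact (hasDerivAt_schwarzInv hw).differentiableAt.differentiableWithinAt
  exact hd.analyticAt ((isOpen_image_schwarzMap isOpen_discSector
    discSector_subset_slitDomain).mem_nhds (mem_image_of_mem _ ht))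

theorem analyticAt_integrand_schwarzInv {t : ℂ} (ht : t ∈ discSector) :
    AnalyticAt ℂ (fun z => integrand (schwarzInv z)) (schwarzMap t) := by
  have h := differentiableOn_integrand.analyticAt
    (isOpen_slitDomain.mem_nhds (discSector_subset_slitDomain ht))
  exact AnalyticAt.comp_of_eq (f := schwarzInv) h (analyticAt_schwarzInv ht)
    (schwarzInv_schwarzMap ht)

/-- The function `t ^ m * (1 + t ^ 6) ^ (-(m + n) / 6)` of `t = s / c`, which equals `s ^ m c ^ n`
on a hexagon. -/
noncomputable def cellFunction (m n : ℤ) (z : ℂ) : ℂ :=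
  schwarzInv z ^ m * integrand (schwarzInv z) ^ ((m + n) / 2)

theorem cellFunction_schwarzMap (m n : ℤ) {t : ℂ} (ht : t ∈ discSector) :
    cellFunction m n (schwarzMap t) = t ^ m * integrand t ^ ((m + n) / 2) := by
  rw [cellFunction, schwarzInv_schwarzMap ht]

/-- The second factor is analytic without zeros, so zeros and poles come from `schwarzInv ^ m`
alone; at a pole the convention `0 ^ m = 0` is the normal-form value. -/
theorem meromorphicNFAt_cellFunction (m n : ℤ) {t : ℂ} (ht : t ∈ discSector) :
    MeromorphicNFAt (cellFunction m n) (schwarzMap t) := by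
  have h1 : MeromorphicNFAt (schwarzInv ^ m) (schwarzMap t) :=
    (analyticAt_schwarzInv ht).meromorphicNFAt.zpow
  have hne : integrand (schwarzInv (schwarzMap t)) ≠ 0 := by
    rw [schwarzInv_schwarzMap ht]
    exact integrand_ne_zero (one_add_ne_zero ht)
  have h2 := (analyticAt_integrand_schwarzInv ht).zpow (n := (m + n) / 2) hne
  exact (meromorphicNFAt_mul_iff_left h2 (zpow_ne_zero _ hne)).2 h1

/-! ### The band -/

/-- The open hexagon about `0` along with its open right-hand edge. -/
def cell : Set ℂ := interior closedHexagon ∪ {z | z.re = K ∧ |z.im| < L / 2}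

theorem mem_band_iff {z : ℂ} : z ∈ band ↔ ∃ n : ℤ, z - 2 * n * K ∈ cell := by
  have h : ∀ n : ℤ, z ∈ sharedEdge n ↔ (z - 2 * n * K).re = K ∧ |(z - 2 * n * K).im| < L / 2 := by
    intro n
    have ht := mem_openSegment_translate ℝ (2 * n * K : ℂ) (x := z - 2 * n * K) (b := L * δ⁻¹)
      (c := L * δ)
    rw [← mem_openSegment_vertices_iff, sharedEdge, ← ht, add_sub_cancel]
  simp only [band, mem_union, mem_iUnion, mem_hexagonAt_iff, h, cell, ← exists_or]
  rfl

theorem cell_re {z : ℂ} (hz : z ∈ cell) : -K < z.re ∧ z.re ≤ K := by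
  rcases hz with hz | hz
  · have := abs_lt.1 (abs_re_lt_of_mem_interior hz)
    exact ⟨this.1, this.2.le⟩
  · exact ⟨by linarith [hz.1, K_pos], hz.1.le⟩

/-- The index of the translate of the strip `-K < re z ≤ K` in which a point lies. -/
noncomputable def stripIndex (z : ℂ) : ℤ := ⌈(z.re - K) / (2 * K)⌉

theorem stripIndex_eq_iff {z : ℂ} {n : ℤ} :
    stripIndex z = n ↔ 2 * n * K - K < z.re ∧ z.re ≤ 2 * n * K + K := by
  have hK := K_pos
  rw [stripIndex, Int.ceil_eq_iff, lt_div_iff₀ (by linarith), div_le_iff₀ (by linarith)]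
  constructor <;> rintro ⟨h1, h2⟩ <;> constructor <;> linarith

theorem stripIndex_add (z : ℂ) : stripIndex (z + 2 * K) = stripIndex z + 1 := by
  have h := stripIndex_eq_iff.1 (rfl : stripIndex z = stripIndex z)
  have e : (z + 2 * K).re = z.re + 2 * K := by simp
  rw [stripIndex_eq_iff, e]
  push_cast
  constructor <;> linarith [h.1, h.2]

theorem mem_cell_of_mem_band {z : ℂ} (hz : z ∈ band) (h1 : -K < z.re) (h2 : z.re ≤ K) :
    z ∈ cell := by
  obtain ⟨n, hn⟩ := mem_band_iff.1 hz
  have h0 : stripIndex z = 0 := stripIndex_eq_iff.2 (by simpa using ⟨h1, h2⟩)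
  have e : (z - 2 * n * K).re = z.re - 2 * n * K := by simp
  have h3 := cell_re hn
  rw [e] at h3
  have h4 : stripIndex z = n := stripIndex_eq_iff.2 ⟨by linarith [h3.1], by linarith [h3.2]⟩
  rw [← h4, h0] at hn
  simpa using hn

theorem cell_subset_band : cell ⊆ band := fun z hz => mem_band_iff.2 ⟨0, by simpa using hz⟩

theorem add_mem_band_iff {z : ℂ} : z + 2 * K ∈ band ↔ z ∈ band := by
  rw [mem_band_iff, mem_band_iff]
  constructor
  · rintro ⟨n, hn⟩
    refine ⟨n - 1, ?_⟩
    convert hn using 1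
    push_cast
    ring
  · rintro ⟨n, hn⟩
    refine ⟨n + 1, ?_⟩
    convert hn using 1
    push_cast
    ring

/-! ### The extension of `s ^ m c ^ n` -/

open Classical in
/-- The extension of `s ^ m c ^ n` from the disc to the band. -/
noncomputable def bandFunction (m n : ℤ) (z : ℂ) : ℂ :=
  if Even (stripIndex z) then cellFunction m n (z - 2 * stripIndex z * K)
  else (-1) ^ m * cellFunction n m (z - 2 * stripIndex z * K)

/-- From an even strip the sign is in the definition; from an odd one the two signs combine to `(-1)
^ (m + n) = 1`. -/
theorem bandFunction_add {m n : ℤ} (hmn : Even (m + n)) (z : ℂ) :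
    bandFunction m n (z + 2 * K) = (-1) ^ m * bandFunction n m z := by
  have e : z + 2 * K - 2 * ((stripIndex z + 1 : ℤ) : ℂ) * K = z - 2 * stripIndex z * K := by
    push_cast
    ring
  have hsign : ((-1 : ℂ)) ^ m * (-1) ^ n = 1 := by
    rw [← zpow_add₀ (by norm_num), hmn.neg_one_zpow]
  rw [bandFunction, bandFunction, stripIndex_add, e]
  by_cases h : Even (stripIndex z)
  · rw [if_neg (by simpa [Int.even_add_one] using h), if_pos h]
  · rw [if_pos (by simpa [Int.even_add_one] using h), if_neg h, ← mul_assoc, hsign, one_mul]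

theorem bandFunction_of_re {m n : ℤ} {z : ℂ} (h1 : -K < z.re) (h2 : z.re ≤ K) :
    bandFunction m n z = cellFunction m n z := by
  have h0 : stripIndex z = 0 := stripIndex_eq_iff.2 (by simpa using ⟨h1, h2⟩)
  simp [bandFunction, h0]

theorem bandFunction_eventuallyEq_of_mem_interior (m n : ℤ) {z : ℂ}
    (hz : z ∈ interior closedHexagon) : bandFunction m n =ᶠ[𝓝 z] cellFunction m n := by
  filter_upwards [isOpen_interior.mem_nhds hz] with w hw
  have := abs_lt.1 (abs_re_lt_of_mem_interior hw)
  exact bandFunction_of_re this.1 this.2.le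

theorem integrand_neg (t : ℂ) : integrand (-t) = integrand t := by
  rw [integrand, integrand, Even.neg_pow (by decide)]

/-- The gluing across the right-hand edge. Beyond it the definition uses the disc point `-1 / t`
with exponents swapped. With `m + n = 2 k`, `(-1) ^ m (-1 / t) ^ n (t² g) ^ k = t ^ m g ^ k`, the
value given by `t` itself. -/
theorem bandFunction_schwarzMap {m n : ℤ} (hmn : Even (m + n)) {t : ℂ} (ht : t ∈ sector)
    (h1 : -K < (schwarzMap t).re) (h2 : (schwarzMap t).re ≤ 3 * K) :
    bandFunction m n (schwarzMap t) = cellFunction m n (schwarzMap t) := by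
  by_cases hK : (schwarzMap t).re ≤ K
  · exact bandFunction_of_re h1 hK
  have ht0 := sector_ne_zero ht
  have hnorm : 1 < ‖t‖ := by
    by_contra h
    rcases (not_lt.1 h).eq_or_lt with h | h
    · exact hK (re_schwarzMap_eq ht h).le
    · exact hK (re_schwarzMap_lt h).le
  have hmem : -t⁻¹ ∈ discSector := by
    left
    rw [mem_ball_zero_iff, norm_neg, norm_inv]
    exact inv_lt_one_of_one_lt₀ hnorm
  have e : schwarzMap t = schwarzMap (-t⁻¹) + 2 * K := by
    rw [schwarzMap_neg, schwarzMap_inv ht]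
    ring
  have hre : (schwarzMap (-t⁻¹)).re = (schwarzMap t).re - 2 * K := by
    rw [e]
    simp
  obtain ⟨k, hk⟩ := hmn
  have hk2 : (m + n) / 2 = k := by omega
  have hk2' : (n + m) / 2 = k := by omega
  rw [cellFunction_schwarzMap m n (Or.inr ht), e, bandFunction_add ⟨k, hk⟩,
    bandFunction_of_re (by rw [hre]; linarith [not_le.1 hK]) (by rw [hre]; linarith),
    cellFunction_schwarzMap n m hmem, integrand_neg, integrand_inv ht, hk2, hk2', mul_zpow,
    neg_eq_neg_one_mul t⁻¹, mul_zpow, inv_zpow, ← mul_assoc, ← mul_assoc, ← mul_assoc,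
    ← zpow_add₀ (by norm_num), Even.neg_one_zpow ⟨k, hk⟩, one_mul]
  congr 1
  rw [← zpow_natCast, ← zpow_mul, ← zpow_neg, ← zpow_add₀ ht0]
  congr 1
  push_cast
  omega

theorem meromorphicNFAt_bandFunction_of_mem_cell {m n : ℤ} (hmn : Even (m + n)) {z : ℂ}
    (hz : z ∈ cell) : MeromorphicNFAt (bandFunction m n) z := by
  have hK := K_pos
  rcases hz with hz | ⟨h1, h2⟩
  · rw [meromorphicNFAt_congr (bandFunction_eventuallyEq_of_mem_interior m n hz)]
    obtain ⟨t, ht, rfl⟩ := interior_subset_image_schwarzMap hz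
    exact meromorphicNFAt_cellFunction m n (Or.inl ht)
  · obtain ⟨θ, hθ, rfl⟩ := exists_schwarzMap_arc_eq h1 h2
    have hs := exp_mul_I_mem_sector hθ
    have hstrict := hasStrictDerivAt_schwarzMap (sector_subset_slitDomain hs)
    refine (meromorphicNFAt_congr ?_).2 (meromorphicNFAt_cellFunction m n (Or.inr hs))
    -- Neighbourhoods of the edge point are images of neighbourhoods of its preimage, so the
    -- comparison can be made in the `t`-plane.
    rw [EventuallyEq, ← hstrict.map_nhds_eq (integrand_ne_zero (one_add_ne_zero (Or.inr hs))),
      eventually_map]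
    have hcont : ContinuousAt (fun t => (schwarzMap t).re) (exp (θ * I)) :=
      continuous_re.continuousAt.comp hstrict.hasDerivAt.continuousAt
    filter_upwards [isOpen_sector.mem_nhds hs,
      hcont.eventually (Ioo_mem_nhds (a := -K) (b := 3 * K) (by linarith) (by linarith))]
      with t ht hre
    exact bandFunction_schwarzMap hmn ht hre.1 hre.2.le

theorem meromorphicNFAt_bandFunction_add_iff {m n : ℤ} (hmn : Even (m + n)) {z : ℂ} :
    MeromorphicNFAt (bandFunction m n) (z + 2 * K) ↔ MeromorphicNFAt (bandFunction n m) z := by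
  rw [← meromorphicNFAt_comp_add_const_iff_meromorphicNFAt]
  have h : bandFunction m n ∘ (· + (2 * K : ℂ)) = (fun _ => (-1) ^ m) * bandFunction n m := by
    ext w
    exact bandFunction_add hmn w
  rw [h]
  exact meromorphicNFAt_mul_iff_right analyticAt_const (zpow_ne_zero _ (by norm_num))

theorem meromorphicNFOn_bandFunction {m n : ℤ} (hmn : Even (m + n)) :
    MeromorphicNFOn (bandFunction m n) band := by
  -- The exponents stay general in the induction because each step swaps them.
  have key : ∀ (j : ℤ) {m n : ℤ}, Even (m + n) → ∀ w ∈ cell,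
      MeromorphicNFAt (bandFunction m n) (w + 2 * j * K) := by
    intro j
    induction j using Int.induction_on with
    | zero =>
      intro m n hmn w hw
      simpa using meromorphicNFAt_bandFunction_of_mem_cell hmn hw
    | succ j ih =>
      intro m n hmn w hw
      have h := (meromorphicNFAt_bandFunction_add_iff hmn).2 (ih (add_comm m n ▸ hmn) w hw)
      convert h using 1
      push_cast
      ring
    | pred j ih =>
      intro m n hmn w hw
      refine (meromorphicNFAt_bandFunction_add_iff (add_comm m n ▸ hmn)).1 ?_
      convert ih (add_comm m n ▸ hmn) w hw using 1
      push_cast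
      ring
  intro z hz
  obtain ⟨j, hj⟩ := mem_band_iff.1 hz
  simpa using key j hmn _ hj

/-! ### The translations of the band -/

theorem add_int_mem_band_iff {z : ℂ} (j : ℤ) : z + 2 * j * K ∈ band ↔ z ∈ band := by
  rw [mem_band_iff, mem_band_iff]
  constructor
  · rintro ⟨n, hn⟩
    refine ⟨n - j, ?_⟩
    convert hn using 1
    push_cast
    ring
  · rintro ⟨n, hn⟩
    refine ⟨n + j, ?_⟩
    convert hn using 1
    push_cast
    ring

theorem im_le_of_mem_cell {z : ℂ} (hz : z ∈ cell) : √3 * |z.im| + |z.re| ≤ √3 * L := by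
  have h : z ∈ closedHexagon := by
    rcases hz with hz | hz
    · exact interior_subset hz
    · exact mem_closedHexagon_of_re_eq hz.1 hz.2.le
  have h1 := im_le_of_mem_closedHexagon h
  have h2 := im_le_of_mem_closedHexagon (neg_mem_closedHexagon h)
  rw [neg_re, neg_im, abs_neg] at h2
  rcases abs_cases z.im with ⟨h, _⟩ | ⟨h, _⟩ <;> rw [h] <;> linarith

theorem abs_im_le_of_mem_band {z : ℂ} (hz : z ∈ band) : |z.im| ≤ L := by
  obtain ⟨n, hn⟩ := mem_band_iff.1 hz
  have h := im_le_of_mem_cell hn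
  have e : (z - 2 * n * K).im = z.im := by simp
  rw [e] at h
  exact le_of_mul_le_mul_left (by linarith [abs_nonneg (z - 2 * n * K).re])
    (Real.sqrt_pos.2 (show (0 : ℝ) < 3 by norm_num))

theorem mul_I_mem_interior {y : ℝ} (h0 : 0 ≤ y) (h1 : y < L) :
    (y : ℂ) * I ∈ interior closedHexagon := by
  have hL := L_pos
  have hv : (L : ℂ) * I ∈ closedHexagon := by
    have h : γ * δ = I := by
      rw [γ, δ, ← exp_add]
      refine Eq.trans ?_ exp_pi_div_two_mul_I
      congr 1
      ring
    rw [← h, mul_left_comm, mul_comm (L : ℂ)]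
    exact γ_mul_mem_closedHexagon δ_mul_L_mem_closedHexagon
  have := convex_closedHexagon.combo_interior_self_mem_interior zero_mem_interior hv
    (a := 1 - y / L) (b := y / L) (sub_pos.2 ((div_lt_one hL).2 h1)) (div_nonneg h0 hL.le)
    (by ring)
  convert this using 1
  rw [smul_zero, zero_add, real_smul, ← mul_assoc, ← ofReal_mul, div_mul_cancel₀ _ hL.ne']

/-- The multiples `n w` stay in a band of bounded height, so `w` is real. Reduced modulo `2 K`, a
nonzero horizontal shift would carry points close below the top vertex `L I` out of the band. -/
theorem exists_int_of_band_translation {w : ℂ} (hw : ∀ z, z + w ∈ band ↔ z ∈ band) :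
    ∃ j : ℤ, w = 2 * j * K := by
  have hK := K_pos
  have hL := L_pos
  have him : w.im = 0 := by
    have hmul : ∀ n : ℕ, (n : ℂ) * w ∈ band := by
      intro n
      induction n with
      | zero => simpa using cell_subset_band (Or.inl zero_mem_interior)
      | succ n ih =>
        convert (hw _).2 ih using 1
        push_cast
        ring
    by_contra hne
    obtain ⟨n, hn⟩ := Archimedean.arch (L + 1) (abs_pos.2 hne)
    have h := abs_im_le_of_mem_band (hmul n)
    rw [show ((n : ℂ) * w).im = n * w.im by simp, abs_mul, Nat.abs_cast] at h
    rw [nsmul_eq_mul] at hn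
    linarith
  refine ⟨stripIndex w, ?_⟩
  set w' := w - 2 * stripIndex w * K with hw'def
  have hw' : ∀ z, z + w' ∈ band ↔ z ∈ band := by
    intro z
    rw [← hw z, ← add_int_mem_band_iff (z := z + w') (stripIndex w)]
    have : z + w' + 2 * stripIndex w * K = z + w := by
      rw [hw'def]
      ring
    rw [this]
  have hre : w'.re = w.re - 2 * stripIndex w * K := by
    rw [hw'def]
    simp
  have him' : w'.im = 0 := by
    rw [hw'def]
    simpa using him
  have hs := stripIndex_eq_iff.1 (rfl : stripIndex w = stripIndex w)
  have h1 : -K < w'.re := by linarith [hs.1]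
  have h2 : w'.re ≤ K := by linarith [hs.2]
  have hs3 : √3 ≤ 2 := by
    rw [Real.sqrt_le_left (by norm_num)]
    norm_num
  have habs : |w'.re| ≤ L := by
    refine (abs_le.2 ⟨h1.le, h2⟩).trans ?_
    rw [K_eq]
    nlinarith
  have hzero : w'.re = 0 := by
    by_contra hne
    have hpos := abs_pos.2 hne
    -- At this height the shifted point violates `im_le_of_mem_cell`, since `√3 / 4 < 1`.
    have hy0 : 0 ≤ L - |w'.re| / 4 := by linarith
    have hy := (hw' _).2 (cell_subset_band (Or.inl (mul_I_mem_interior hy0 (by linarith))))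
    have e1 : (((L - |w'.re| / 4 : ℝ) : ℂ) * I + w').re = w'.re := by simp
    have e2 : (((L - |w'.re| / 4 : ℝ) : ℂ) * I + w').im = L - |w'.re| / 4 := by
      rw [add_im, him', im_ofReal_mul, I_im]
      ring
    have h := im_le_of_mem_cell (mem_cell_of_mem_band hy (by rwa [e1]) (by rwa [e1]))
    rw [e1, e2, abs_of_nonneg hy0] at h
    nlinarith
  have : w' = 0 := Complex.ext hzero him'
  exact sub_eq_zero.1 this

/-! ### The periods of the extension -/

theorem four_mul_K_mem_periods {m n : ℤ} (hmn : Even (m + n)) :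
    (4 * K : ℂ) ∈ periods (bandFunction m n) band := by
  have hsign : ((-1 : ℂ)) ^ m * (-1) ^ n = 1 := by
    rw [← zpow_add₀ (by norm_num), hmn.neg_one_zpow]
  intro z
  have e : z + 4 * K = z + 2 * K + 2 * K := by ring
  rw [e, add_mem_band_iff, add_mem_band_iff, bandFunction_add hmn,
    bandFunction_add (add_comm m n ▸ hmn), ← mul_assoc, hsign, one_mul]
  exact ⟨Iff.rfl, fun _ => rfl⟩

theorem bandFunction_schwarzMap_of_norm_lt_one (m n : ℤ) {t : ℂ} (ht : ‖t‖ < 1) :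
    bandFunction m n (schwarzMap t) = t ^ m * integrand t ^ ((m + n) / 2) := by
  rw [(bandFunction_eventuallyEq_of_mem_interior m n (schwarzMap_mem_interior ht)).eq_of_nhds,
    cellFunction_schwarzMap m n (Or.inl (by simpa using ht))]

theorem schwarzMap_mem_band {t : ℂ} (ht : ‖t‖ < 1) : schwarzMap t ∈ band :=
  cell_subset_band (Or.inl (schwarzMap_mem_interior ht))

theorem two_mul_K_mem_periods_iff {m n : ℤ} (hmn : (4 : ℤ) ∣ m + n) :
    (2 * K : ℂ) ∈ periods (bandFunction m n) band ↔ m = n := by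
  have heven : Even (m + n) := (even_iff_two_dvd.2 ((by norm_num : (2 : ℤ) ∣ 4).trans hmn))
  constructor
  · intro h
    -- At `t = 1 / 2` the integrand factor is common to both sides and cancels, leaving `2 ^ (-m) =
    -- 2 ^ (-n)` in modulus.
    have ht : ‖(1 / 2 : ℂ)‖ < 1 := by norm_num
    have h1 := (h (schwarzMap (1 / 2))).2 (schwarzMap_mem_band ht)
    have hne : integrand (1 / 2) ^ ((m + n) / 2) ≠ 0 :=
      zpow_ne_zero _ (integrand_ne_zero
        (one_add_ne_zero_of_mem_slitDomain (mem_slitDomain_of_norm_lt_one ht)))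
    rw [bandFunction_add heven, bandFunction_schwarzMap_of_norm_lt_one _ _ ht,
      bandFunction_schwarzMap_of_norm_lt_one _ _ ht, add_comm n m, ← mul_assoc] at h1
    have h2 := congrArg norm (mul_right_cancel₀ hne h1)
    simp only [norm_mul, norm_zpow, norm_neg, norm_one, one_zpow, one_mul, one_div, norm_inv,
      norm_ofNat] at h2
    exact (zpow_right_injective₀ (by norm_num) (by norm_num) h2).symm
  · rintro rfl z
    have hm : Even m := by
      obtain ⟨k, hk⟩ := hmn
      exact ⟨k, by omega⟩
    rw [add_mem_band_iff, bandFunction_add heven, hm.neg_one_zpow, one_mul]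
    exact ⟨Iff.rfl, fun _ => rfl⟩

theorem periods_bandFunction_self {m : ℤ} (hm : (4 : ℤ) ∣ m + m) :
    periods (bandFunction m m) band = AddSubgroup.zmultiples (2 * K : ℂ) := by
  apply le_antisymm
  · intro w hw
    obtain ⟨j, rfl⟩ := exists_int_of_band_translation fun z => (hw z).1
    rw [AddSubgroup.mem_zmultiples_iff]
    exact ⟨j, by rw [zsmul_eq_mul]; ring⟩
  · rw [AddSubgroup.zmultiples_le]
    exact (two_mul_K_mem_periods_iff hm).2 rfl

theorem periods_bandFunction_of_ne {m n : ℤ} (hmn : (4 : ℤ) ∣ m + n) (hne : m ≠ n) :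
    periods (bandFunction m n) band = AddSubgroup.zmultiples (4 * K : ℂ) := by
  have h4 := four_mul_K_mem_periods
    (even_iff_two_dvd.2 ((by norm_num : (2 : ℤ) ∣ 4).trans hmn))
  apply le_antisymm
  · intro w hw
    obtain ⟨j, rfl⟩ := exists_int_of_band_translation fun z => (hw z).1
    rw [AddSubgroup.mem_zmultiples_iff]
    rcases Int.even_or_odd' j with ⟨i, rfl | rfl⟩
    · exact ⟨i, by rw [zsmul_eq_mul]; push_cast; ring⟩
    -- An odd multiple of `2 K` would, modulo `4 K`, make `2 K` itself a period.
    · refine absurd ((two_mul_K_mem_periods_iff hmn).1 ?_) hne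
      convert AddSubgroup.sub_mem _ hw (AddSubgroup.zsmul_mem _ h4 i) using 1
      rw [zsmul_eq_mul]
      push_cast
      ring
  · rwa [AddSubgroup.zmultiples_le]

theorem bandFunction_not_const {m n : ℤ} (hmn : Even (m + n)) (h0 : ¬(m = 0 ∧ n = 0)) :
    ¬∃ a : ℂ, ∀ z ∈ band, bandFunction m n z = a := by
  rintro ⟨a, ha⟩
  have ht : ‖(1 / 2 : ℂ)‖ < 1 := by norm_num
  have hne : (1 : ℂ) + (1 / 2) ^ 6 ≠ 0 :=
    one_add_ne_zero_of_mem_slitDomain (mem_slitDomain_of_norm_lt_one ht)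
  have h1 := ha _ (schwarzMap_mem_band ht)
  rw [← ha _ (schwarzMap_mem_band (t := 0) (by simp)),
    bandFunction_schwarzMap_of_norm_lt_one _ _ ht,
    bandFunction_schwarzMap_of_norm_lt_one _ _ (by simp), integrand_zero, one_zpow, mul_one] at h1
  -- The values at `t = 0` and `t = 1 / 2` are compared. For `m = 0` the cube of the second has
  -- modulus `(1 + 2 ^ (-6)) ^ (-k) ≠ 1`; otherwise the first is `0`, by convention if `m < 0`, and
  -- the second is not.
  by_cases hm : m = 0
  · subst hm
    obtain ⟨k, hk⟩ := hmn
    have hk0 : k ≠ 0 := fun h => h0 ⟨rfl, by omega⟩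
    rw [show (0 + n) / 2 = k by omega, zpow_zero, zpow_zero, one_mul] at h1
    have h2 := congrArg (fun x : ℂ => ‖x ^ 3‖) h1
    simp only [one_pow, norm_one] at h2
    rw [← zpow_natCast, ← zpow_mul, mul_comm, zpow_mul, zpow_natCast, integrand_pow_three,
      norm_zpow] at h2
    have hn1 : ‖((1 : ℂ) + (1 / 2) ^ 6)⁻¹‖ ≠ 1 := by norm_num
    rcases (zpow_eq_one_iff_of_ne_zero₀ hk0).1 h2 with h | h
    · exact hn1 h
    · linarith [norm_nonneg ((1 : ℂ) + (1 / 2) ^ 6)⁻¹, h.1]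
  · rw [zero_zpow m hm] at h1
    exact mul_ne_zero (zpow_ne_zero _ (by norm_num)) (zpow_ne_zero _ (integrand_ne_zero hne)) h1

/-! ### The solution pair -/

theorem IsSolutionPair.pow_six_add_pow_six {s c : ℂ → ℂ} (h : IsSolutionPair s c) {z : ℂ}
    (hz : z ∈ Metric.ball (0 : ℂ) (4 ^ 4 / 5 ^ 5)) : s z ^ 6 + c z ^ 6 = 1 := by
  have hder : ∀ w ∈ Metric.ball (0 : ℂ) (4 ^ 4 / 5 ^ 5),
      HasDerivAt (fun w => s w ^ 6 + c w ^ 6) 0 w := by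
    intro w hw
    refine (((h.hasDerivAt_s w hw).pow 6).add ((h.hasDerivAt_c w hw).pow 6)).congr_deriv ?_
    ring
  have hconst := Metric.isOpen_ball.is_const_of_deriv_eq_zero
    (convex_ball (0 : ℂ) (4 ^ 4 / 5 ^ 5)).isPreconnected
    (fun w hw => (hder w hw).differentiableAt.differentiableWithinAt)
    (fun w hw => (hder w hw).deriv) hz (Metric.mem_ball_self (by norm_num))
  simpa [h.s_zero, h.c_zero] using hconst

/-- `integrand (s / c)` and `c ^ 2` have equal cubes and agree at `0`, hence agree nearby. Then `S
(s / c)` has derivative `c ^ 2 * c⁻² = 1`, so it is the identity. -/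
theorem IsSolutionPair.eventually_eq {s c : ℂ → ℂ} (h : IsSolutionPair s c) :
    ∀ᶠ z in 𝓝 (0 : ℂ), s z = schwarzInv z * c z ∧ c z ^ 2 = integrand (schwarzInv z) := by
  have hr : (0 : ℂ) ∈ Metric.ball (0 : ℂ) (4 ^ 4 / 5 ^ 5) := Metric.mem_ball_self (by norm_num)
  have hs := (h.hasDerivAt_s 0 hr).continuousAt
  have hc := (h.hasDerivAt_c 0 hr).continuousAt
  have hc0 : c 0 ≠ 0 := by simp [h.c_zero]
  have ht : ContinuousAt (fun z => s z / c z) 0 := hs.div hc hc0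
  have ht0 : s 0 / c 0 = 0 := by simp [h.s_zero]
  have hg : ContinuousAt (fun z => integrand (s z / c z)) 0 := by
    have h1 := (differentiableOn_integrand.differentiableAt
      (isOpen_slitDomain.mem_nhds (mem_slitDomain_of_norm_lt_one (t := 0) (by simp)))).continuousAt
    exact ContinuousAt.comp_of_eq (f := fun z => s z / c z) h1 ht ht0
  have hq : ContinuousAt (fun z => integrand (s z / c z) ^ 2 + integrand (s z / c z) * c z ^ 2
      + c z ^ 4) 0 := ((hg.pow 2).add (hg.mul (hc.pow 2))).add (hc.pow 4)
  have hsmall : ∀ᶠ z in 𝓝 (0 : ℂ), z ∈ Metric.ball (0 : ℂ) (4 ^ 4 / 5 ^ 5) ∧ c z ≠ 0 ∧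
      ‖s z / c z‖ < 1 ∧ integrand (s z / c z) ^ 2 + integrand (s z / c z) * c z ^ 2
      + c z ^ 4 ≠ 0 := by
    refine (Metric.isOpen_ball.eventually_mem hr).and ((hc.eventually_ne hc0).and
      (Eventually.and ?_ (hq.eventually_ne ?_)))
    · exact ht.norm.eventually_lt continuousAt_const (by simp [ht0])
    -- The cofactor in the difference of cubes equals `3` at `0`.
    · rw [ht0, integrand_zero, h.c_zero]
      norm_num
  obtain ⟨ε, hε, hball⟩ := Metric.eventually_nhds_iff_ball.1 hsmall
  have hgc : ∀ z ∈ Metric.ball (0 : ℂ) ε, integrand (s z / c z) = c z ^ 2 := by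
    intro z hz
    obtain ⟨hzr, hcz, _, hne⟩ := hball z hz
    have h6 : (1 + (s z / c z) ^ 6)⁻¹ = c z ^ 6 := by
      refine inv_eq_of_mul_eq_one_left ?_
      rw [div_pow, mul_add, mul_one, mul_div_cancel₀ _ (pow_ne_zero 6 hcz), add_comm]
      exact h.pow_six_add_pow_six hzr
    have h3 : integrand (s z / c z) ^ 3 = c z ^ 6 := by rw [integrand_pow_three, h6]
    have : (integrand (s z / c z) - c z ^ 2) * (integrand (s z / c z) ^ 2
        + integrand (s z / c z) * c z ^ 2 + c z ^ 4) = 0 := by linear_combination h3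
    exact sub_eq_zero.1 ((mul_eq_zero.1 this).resolve_right hne)
  have hder : ∀ z ∈ Metric.ball (0 : ℂ) ε,
      HasDerivAt (fun z => schwarzMap (s z / c z) - z) 0 z := by
    intro z hz
    obtain ⟨hzr, hcz, htz, _⟩ := hball z hz
    have h1 := (h.hasDerivAt_s z hzr).div (h.hasDerivAt_c z hzr) hcz
    have h2 := HasDerivAt.comp_of_eq z
      (hasDerivAt_schwarzMap (mem_slitDomain_of_norm_lt_one htz)) h1 rfl
    refine (h2.sub (hasDerivAt_id z)).congr_deriv ?_
    rw [hgc z hz]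
    field_simp
    linear_combination h.pow_six_add_pow_six hzr
  refine Metric.eventually_nhds_iff_ball.2 ⟨ε, hε, fun z hz => ?_⟩
  have hconst := Metric.isOpen_ball.is_const_of_deriv_eq_zero
    (convex_ball (0 : ℂ) ε).isPreconnected
    (fun w hw => (hder w hw).differentiableAt.differentiableWithinAt)
    (fun w hw => (hder w hw).deriv) hz (Metric.mem_ball_self hε)
  simp only [ht0, schwarzMap_zero, sub_zero] at hconst
  obtain ⟨_, hcz, htz, _⟩ := hball z hz
  have hT : schwarzInv z = s z / c z := by
    rw [← schwarzInv_schwarzMap (t := s z / c z) (Or.inl (by simpa using htz)),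
      sub_eq_zero.1 hconst]
  rw [hT, hgc z hz]
  exact ⟨(div_mul_cancel₀ _ hcz).symm, rfl⟩

theorem ball_radius_subset : Metric.ball (0 : ℂ) (4 ^ 4 / 5 ^ 5) ⊆ Metric.ball 0 K :=
  Metric.ball_subset_ball (by linarith [half_le_K])

/-- The identity theorem spreads the local identities. They are stated without dividing by `c`,
which is not yet known to be nonzero on the whole disc. -/
theorem IsSolutionPair.eq_on_ball {s c : ℂ → ℂ} (h : IsSolutionPair s c) {z : ℂ}
    (hz : z ∈ Metric.ball (0 : ℂ) (4 ^ 4 / 5 ^ 5)) :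
    s z = schwarzInv z * c z ∧ c z ^ 2 = integrand (schwarzInv z) := by
  have hr : (0 : ℂ) ∈ Metric.ball (0 : ℂ) (4 ^ 4 / 5 ^ 5) := Metric.mem_ball_self (by norm_num)
  have hpre := (convex_ball (0 : ℂ) (4 ^ 4 / 5 ^ 5)).isPreconnected
  have hsa : AnalyticOnNhd ℂ s (Metric.ball (0 : ℂ) (4 ^ 4 / 5 ^ 5)) :=
    DifferentiableOn.analyticOnNhd
      (fun w hw => (h.hasDerivAt_s w hw).differentiableAt.differentiableWithinAt)
      Metric.isOpen_ball
  have hca : AnalyticOnNhd ℂ c (Metric.ball (0 : ℂ) (4 ^ 4 / 5 ^ 5)) :=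
    DifferentiableOn.analyticOnNhd
      (fun w hw => (h.hasDerivAt_c w hw).differentiableAt.differentiableWithinAt)
      Metric.isOpen_ball
  have hTa : AnalyticOnNhd ℂ schwarzInv (Metric.ball (0 : ℂ) (4 ^ 4 / 5 ^ 5)) := by
    intro w hw
    obtain ⟨t, ht, rfl⟩ := ball_subset_image_schwarzMap (ball_radius_subset hw)
    exact analyticAt_schwarzInv (Or.inl ht)
  have hga : AnalyticOnNhd ℂ (fun z => integrand (schwarzInv z))
      (Metric.ball (0 : ℂ) (4 ^ 4 / 5 ^ 5)) := by
    intro w hw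
    obtain ⟨t, ht, rfl⟩ := ball_subset_image_schwarzMap (ball_radius_subset hw)
    exact analyticAt_integrand_schwarzInv (Or.inl ht)
  exact ⟨hsa.eqOn_of_preconnected_of_eventuallyEq (hTa.mul hca) hpre hr
      (h.eventually_eq.mono fun _ h => h.1) hz,
    (hca.pow 2).eqOn_of_preconnected_of_eventuallyEq hga hpre hr
      (h.eventually_eq.mono fun _ h => h.2) hz⟩

theorem IsSolutionPair.bandFunction_eq {s c : ℂ → ℂ} (h : IsSolutionPair s c) {m n : ℤ}
    (hmn : Even (m + n)) {z : ℂ} (hz : z ∈ Metric.ball (0 : ℂ) (4 ^ 4 / 5 ^ 5)) :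
    bandFunction m n z = s z ^ m * c z ^ n := by
  obtain ⟨hs, hc⟩ := h.eq_on_ball hz
  obtain ⟨t, ht, rfl⟩ := ball_subset_image_schwarzMap (ball_radius_subset hz)
  have ht1 : ‖t‖ < 1 := by simpa using ht
  rw [schwarzInv_schwarzMap (Or.inl ht)] at hs hc
  have hc0 : c (schwarzMap t) ≠ 0 := by
    intro h0
    rw [h0, zero_pow two_ne_zero] at hc
    exact integrand_ne_zero (one_add_ne_zero (Or.inl ht)) hc.symm
  obtain ⟨k, hk⟩ := hmn
  rw [bandFunction_schwarzMap_of_norm_lt_one m n ht1, hs, ← hc, mul_zpow, mul_assoc,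
    ← zpow_add₀ hc0, ← zpow_natCast, ← zpow_mul]
  congr 2
  push_cast
  omega

end SexticSystem

theorem theorem13 (s c : ℂ → ℂ) (hsc : SexticSystem.IsSolutionPair s c)
    (m n : ℤ) (hmn : (4 : ℤ) ∣ m + n) (h0 : ¬ (m = 0 ∧ n = 0)) :
    ∃ F : ℂ → ℂ,
      MeromorphicNFOn F SexticSystem.band ∧
      Metric.ball (0 : ℂ) (4 ^ 4 / 5 ^ 5) ⊆ SexticSystem.band ∧
      (∀ z ∈ Metric.ball (0 : ℂ) (4 ^ 4 / 5 ^ 5), F z = s z ^ m * c z ^ n) ∧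
      SexticSystem.IsSimplyPeriodicOn F SexticSystem.band ∧
      (m = n → SexticSystem.periods F SexticSystem.band =
        AddSubgroup.zmultiples (2 * (SexticSystem.K : ℂ))) ∧
      (m ≠ n → SexticSystem.periods F SexticSystem.band =
        AddSubgroup.zmultiples (4 * (SexticSystem.K : ℂ))) := by
  open SexticSystem in
  have heven : Even (m + n) := even_iff_two_dvd.2 ((by norm_num : (2 : ℤ) ∣ 4).trans hmn)
  have hK : (K : ℂ) ≠ 0 := Complex.ofReal_ne_zero.2 K_pos.ne'
  refine ⟨bandFunction m n, meromorphicNFOn_bandFunction heven, ?_,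
    fun z hz => hsc.bandFunction_eq heven hz, ⟨bandFunction_not_const heven h0, ?_⟩, ?_,
    periods_bandFunction_of_ne hmn⟩
  · intro z hz
    obtain ⟨t, ht, rfl⟩ := ball_subset_image_schwarzMap (ball_radius_subset hz)
    exact schwarzMap_mem_band (by simpa using ht)
  · by_cases hne : m = n
    · subst hne
      exact ⟨2 * K, mul_ne_zero two_ne_zero hK, periods_bandFunction_self hmn⟩
    · exact ⟨4 * K, mul_ne_zero (by norm_num) hK, periods_bandFunction_of_ne hmn hne⟩
  · rintro rfl
    exact periods_bandFunction_self hmn
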